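/- Let $\square=(0,1)^2$ and let $G_0$ be a finite union of smooth planar domains whose closures are pairwise disjoint and contained in $\square$. Put $Y=\overline{\square}\setminus\overline{G_0}$, denote by $|Y|$ its area, let $\langle u\rangle_Y=\frac1{|Y|}\int_Y u\,d\xi$, and assume that $Y$ is symmetric with respect to the lines $\xi_1=\frac12$ and $\xi_2=\frac12$. Let $G=\bigcup_{k,n\in\mathbb Z}(G_0+(k,n))$, and let $\vec\nu=(\nu_1,\nu_2)$ on the boundaries of the holes be the unit normal directed into the holes. Let $N_1$ be a solution, $1$-periodic in $\xi_1$ and $\xi_2$ and smooth on $\mathbb R^2\setminus G$ (up to the boundaries of the holes), of the cell problem $$\Delta N_1=0\ \text{ in } Y,\qquad \nabla N_1\cdot\vec\nu=-\nu_1\ \text{ on }\partial G_0,\qquad \langle N_1\rangle_Y=0,$$ and put $h_{11}=\langle 1+\partial_{\xi_1}N_1\rangle_Y$. Let $\ell\in C^4(\mathbb R)$ be $1$-periodic, even and non-positive with $\ell(0)=0$, and assume that the curve $\xi_1=\ell(\xi_2)$, $\xi_2\in\mathbb R$, does not meet $\partial G$. Let $$\lambda=\{\xi:\ \xi_1=\ell(\xi_2),\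 0<\xi_2<1\},\qquad \vec\nu=(\nu_1,\nu_2)=\frac{(1,\,-\ell'(\xi_2))}{\sqrt{1+|\ell'(\xi_2)|^2}}\ \text{ on }\lambda .$$ Then $$\int_\lambda\nabla N_1\cdot\vec\nu\,dl=-1+|Y|\,h_{11}.$$ Moreover, this number is the constant $\tilde J_1$ of the inner-layer problem, in the following sense. Let $\Upsilon^-=\{\xi_1<\ell(\xi_2),\ 0<\xi_2<1\}$ and $\Upsilon^+=\{\xi_1>\ell(\xi_2),\ 0<\xi_2<1\}\setminus\overline G$, and let $\mathfrak S^+$ be the part of $\partial G$ in $\{\xi_1>\ell(\xi_2),\ 0<\xi_2<1\}$. If $D^->0$, $q_1,\tilde J_1\in\mathbb R$, and if functions $B^\pm$, which are $1$-periodic in $\xi_2$ and twice continuously differentiable up to the interface and up to the boundaries of the holes, satisfy $$\Delta B^\pm=0\ \text{ in }\Upsilon^\pm,\qquad \nabla B^+\cdot\vec\nu=0\ \text{ on }\mathfrak S^+,\qquad B^+-B^-=-N_1+q_1\ \text{ on }\lambda,$$ $$(\nabla B^+-D^-\nabla B^-)\cdot\vec\nu=-\nabla N_1\cdot\vec\nu+\tilde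 J_1\,\nu_1\ \text{ on }\lambda,\qquad B^\pm\to0\ \text{ as }\xi_1\to\pm\infty\ \text{ uniformly in }\xi_2,$$ then $$\tilde J_1=\int_\lambda\nabla N_1\cdot\vec\nu\,dl=-1+|Y|\,h_{11}.$$ -/

import Mathlib

open MeasureTheory Filter Topology Set
open scoped ContDiff

namespace PerforatedCell

noncomputable section

/-- The partial derivative in the first variable. -/
def d1 (u : ℝ × ℝ → ℝ) (x : ℝ × ℝ) : ℝ := fderiv ℝ u x (1, 0)

/-- The partial derivative in the second variable. -/
def d2 (u : ℝ × ℝ → ℝ) (x : ℝ × ℝ) : ℝ := fderiv ℝ u x (0, 1)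

/-- The Laplace operator. -/
def lap (u : ℝ × ℝ → ℝ) (x : ℝ × ℝ) : ℝ := d1 (d1 u) x + d2 (d2 u) x

/-- The derivative of `u` at `x` in the direction `n`, that is `∇u(x) · n`. -/
def normalDeriv (u : ℝ × ℝ → ℝ) (x n : ℝ × ℝ) : ℝ := d1 u x * n.1 + d2 u x * n.2

/-- `ψ` is a smooth defining function of the set `S` near `x`: its gradient does not vanish at `x`
and near `x` the set `S` is `{ψ < 0}`. -/
def IsDefiningFunction (S : Set (ℝ × ℝ)) (x : ℝ × ℝ) (ψ : ℝ × ℝ → ℝ) : Prop :=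
  ContDiff ℝ ∞ ψ ∧ fderiv ℝ ψ x ≠ 0 ∧ ∀ᶠ y in 𝓝 x, (y ∈ S ↔ ψ y < 0)

/-- A smooth domain: a nonempty connected open set with a smooth boundary, lying locally on one
side of it. -/
structure IsSmoothDomain (D : Set (ℝ × ℝ)) : Prop where
  isOpen : IsOpen D
  isConnected : IsConnected D
  smooth_boundary : ∀ x ∈ frontier D, ∃ ψ, IsDefiningFunction D x ψ

/-- `n` is the unit normal to the boundary of `S` at `x` that is directed into `S`, hence external
to the complement of `S`. -/
def IsUnitNormalInto (S : Set (ℝ × ℝ)) (x n : ℝ × ℝ) : Prop :=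
  n.1 ^ 2 + n.2 ^ 2 = 1 ∧
    ∃ ψ, IsDefiningFunction S x ψ ∧ ∃ t : ℝ, 0 < t ∧ d1 ψ x = -t * n.1 ∧ d2 ψ x = -t * n.2

/-- `G` is a finite union of smooth domains whose closures are pairwise disjoint and lie strictly
inside the unit square. -/
def IsHoleSystem (G : Set (ℝ × ℝ)) : Prop :=
  ∃ (m : ℕ) (D : Fin m → Set (ℝ × ℝ)),
    (∀ i, IsSmoothDomain (D i)) ∧
    (∀ i j, i ≠ j → Disjoint (closure (D i)) (closure (D j))) ∧
    (∀ i, closure (D i) ⊆ Ioo (0 : ℝ) 1 ×ˢ Ioo (0 : ℝ) 1) ∧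
    G = ⋃ i, D i

/-- The periodicity cell: the closed unit square without the closed holes. -/
def cell (G : Set (ℝ × ℝ)) : Set (ℝ × ℝ) :=
  (Icc (0 : ℝ) 1 ×ˢ Icc (0 : ℝ) 1) \ closure G

/-- The cell is symmetric with respect to the lines `ξ₁ = 1/2` and `ξ₂ = 1/2`. -/
def IsSymmetricCell (G : Set (ℝ × ℝ)) : Prop :=
  (∀ x, x ∈ cell G ↔ (1 - x.1, x.2) ∈ cell G) ∧ (∀ x, x ∈ cell G ↔ (x.1, 1 - x.2) ∈ cell G)

/-- All integer translates of the holes. -/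
def periodicHoles (G : Set (ℝ × ℝ)) : Set (ℝ × ℝ) :=
  {x | ∃ k n : ℤ, (x.1 - k, x.2 - n) ∈ G}

/-- The mean value over the cell. -/
def cellAverage (G : Set (ℝ × ℝ)) (u : ℝ × ℝ → ℝ) : ℝ :=
  (1 / volume.real (cell G)) * ∫ x in cell G, u x

/-- `N` is a smooth periodic solution of the first cell problem. Only its values on the closed
perforated plane `(periodicHoles G)ᶜ` matter; smoothness up to the boundary means that `N` is
smooth near every point of that closed set. -/
structure IsCellSolution (G : Set (ℝ × ℝ)) (N : ℝ × ℝ → ℝ) : Prop where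
  smooth : ∀ x, x ∉ periodicHoles G → ContDiffAt ℝ ∞ N x
  periodic_fst : ∀ x : ℝ × ℝ, N (x.1 + 1, x.2) = N x
  periodic_snd : ∀ x : ℝ × ℝ, N (x.1, x.2 + 1) = N x
  harmonic : ∀ x ∈ cell G, lap N x = 0
  neumann : ∀ x ∈ frontier G, ∀ n, IsUnitNormalInto G x n → normalDeriv N x n = -n.1
  mean_zero : cellAverage G N = 0

/-- The homogenized coefficient `h₁₁ = ⟨1 + ∂N₁/∂ξ₁⟩_Y`. -/
def h11 (G : Set (ℝ × ℝ)) (N : ℝ × ℝ → ℝ) : ℝ := cellAverage G fun x => 1 + d1 N x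

/-- The profile of the interface: the curve `ξ₁ = ell ξ₂` does not meet the boundary of any hole
of the perforated plane. -/
structure IsInterfaceProfile (G : Set (ℝ × ℝ)) (ell : ℝ → ℝ) : Prop where
  smooth : ContDiff ℝ 4 ell
  periodic : ∀ t, ell (t + 1) = ell t
  even : ∀ t, ell (-t) = ell t
  nonpos : ∀ t, ell t ≤ 0
  zero : ell 0 = 0
  avoids_holes : ∀ t, (ell t, t) ∉ frontier (periodicHoles G)

/-- The unit normal `(1, -ell') / √(1 + ell'²)` to the interface at the point `(ell t, t)`. -/
def interfaceNormal (ell : ℝ → ℝ) (t : ℝ) : ℝ × ℝ :=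
  (1 / √(1 + deriv ell t ^ 2), -deriv ell t / √(1 + deriv ell t ^ 2))

/-- The integral with respect to arc length over the curve `λ = {(ell t, t) : 0 < t < 1}` of a
function given in terms of the parameter `t`. -/
def lineIntegral (ell : ℝ → ℝ) (f : ℝ → ℝ) : ℝ :=
  ∫ t in (0 : ℝ)..1, f t * √(1 + deriv ell t ^ 2)

/-- The part of the band `0 < ξ₂ < 1` on the left of the interface. -/
def bandMinus (ell : ℝ → ℝ) : Set (ℝ × ℝ) :=
  {x | x.1 < ell x.2 ∧ 0 < x.2 ∧ x.2 < 1}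

/-- The perforated part of the band `0 < ξ₂ < 1` on the right of the interface. -/
def bandPlus (G : Set (ℝ × ℝ)) (ell : ℝ → ℝ) : Set (ℝ × ℝ) :=
  {x | ell x.2 < x.1 ∧ 0 < x.2 ∧ x.2 < 1 ∧ x ∉ closure (periodicHoles G)}

/-- The pair `Bp`, `Bm` solves the first inner-layer problem with the constants `q` and `J`; `Dm`
is the diffusion coefficient on the left of the interface. Each of the functions is `1`-periodic
in the second variable and twice continuously differentiable up to the interface and to the
boundaries of the holes, and tends to zero at infinity uniformly in the second variable. -/
structure IsInnerLayerSolution (G : Set (ℝ × ℝ)) (ell : ℝ → ℝ) (N : ℝ × ℝ → ℝ) (Dm q J : ℝ)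
    (Bp Bm : ℝ × ℝ → ℝ) : Prop where
  smooth_plus : ∀ x : ℝ × ℝ, ell x.2 ≤ x.1 → x ∉ periodicHoles G → ContDiffAt ℝ 2 Bp x
  smooth_minus : ∀ x : ℝ × ℝ, x.1 ≤ ell x.2 → ContDiffAt ℝ 2 Bm x
  periodic_plus : ∀ x : ℝ × ℝ, Bp (x.1, x.2 + 1) = Bp x
  periodic_minus : ∀ x : ℝ × ℝ, Bm (x.1, x.2 + 1) = Bm x
  harmonic_plus : ∀ x ∈ bandPlus G ell, lap Bp x = 0
  harmonic_minus : ∀ x ∈ bandMinus ell, lap Bm x = 0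
  neumann : ∀ x ∈ frontier (periodicHoles G), ell x.2 < x.1 → 0 < x.2 → x.2 < 1 →
    ∀ n, IsUnitNormalInto (periodicHoles G) x n → normalDeriv Bp x n = 0
  jump : ∀ t ∈ Ioo (0 : ℝ) 1, Bp (ell t, t) - Bm (ell t, t) = -N (ell t, t) + q
  flux_jump : ∀ t ∈ Ioo (0 : ℝ) 1,
    normalDeriv Bp (ell t, t) (interfaceNormal ell t)
        - Dm * normalDeriv Bm (ell t, t) (interfaceNormal ell t)
      = -normalDeriv N (ell t, t) (interfaceNormal ell t) + J * (interfaceNormal ell t).1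
  decay_plus : Tendsto Bp (comap Prod.fst atTop ⊓ 𝓟 (bandPlus G ell)) (𝓝 0)
  decay_minus : Tendsto Bm (comap Prod.fst atBot ⊓ 𝓟 (bandMinus ell)) (𝓝 0)

end

end PerforatedCell

/-!
The field `F = e₁ + ∇N₁` is periodic, divergence-free and tangential to the holes. Green's formula
with the test function `ξ₁`, on the sheared cell between the interface and its shift by one period,
equates the flux of `F` through the interface with `∫ (1 + ∂₁N₁)` over the perforated part of the
sheared cell. By periodicity the sheared cell may be replaced by `Y`, and since `e₁` has flux `1`,
this is the formula for the flux of `∇N₁`.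

For the inner layer, the flux of `∇B^±` through the shifted interface does not depend on the shift.
On a sheared cell of width one, a Caccioppoli-type estimate bounds it by a multiple of `sup |B^±|`,
so it vanishes by the decay of `B^±`. Integrating the flux jump over the interface identifies the
constant.

The holes do not contribute to Green's formula: after localisation by a partition of unity, a field
is cut off near a hole by `η (n ψ)` with a defining function `ψ`, and since tangentiality gives
`dψ(F) = O(ψ)`, the error terms tend to `0`.
-/

namespace PerforatedCell

section SmoothTransition

lemma deriv_smoothTransition_eq_zero {s : ℝ} (hs : s ∉ Ioo (0 : ℝ) 1) :
    deriv Real.smoothTransition s = 0 := by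
  rcases not_and_or.1 hs with h | h <;> rw [not_lt] at h
  · refine IsLocalMin.deriv_eq_zero (Eventually.of_forall fun t => ?_)
    rw [Real.smoothTransition.zero_of_nonpos h]
    exact Real.smoothTransition.nonneg t
  · refine IsLocalMax.deriv_eq_zero (Eventually.of_forall fun t => ?_)
    rw [Real.smoothTransition.one_of_one_le h]
    exact Real.smoothTransition.le_one t

lemma exists_abs_deriv_smoothTransition_le : ∃ M, ∀ s, |deriv Real.smoothTransition s| ≤ M :=
  (HasCompactSupport.intro isCompact_Icc fun _ hs =>
    deriv_smoothTransition_eq_zero fun h => hs (Ioo_subset_Icc_self h)).exists_bound_of_continuous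
      ((Real.smoothTransition.contDiff (n := 1)).continuous_deriv le_rfl)

lemma eventually_one_le_natCast_mul {s : ℝ} (hs : 0 < s) : ∀ᶠ n : ℕ in atTop, 1 ≤ n * s :=
  (tendsto_natCast_atTop_atTop.atTop_mul_const hs).eventually_ge_atTop 1

variable {X : Type*} [TopologicalSpace X] [MeasurableSpace X] [OpensMeasurableSpace X]
  {μ : Measure X}

lemma tendsto_integral_smoothTransition_mul {ψ g : X → ℝ} (hψ : Continuous ψ)
    (hg : Integrable g μ) :
    Tendsto (fun n : ℕ => ∫ x, Real.smoothTransition (n * ψ x) * g x ∂μ) atTop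
      (𝓝 (∫ x in {y | 0 < ψ y}, g x ∂μ)) := by
  rw [← integral_indicator (isOpen_lt continuous_const hψ).measurableSet]
  refine tendsto_integral_of_dominated_convergence (fun x => ‖g x‖) (fun n => ?_) hg.norm
    (fun n => Eventually.of_forall fun x => ?_) (Eventually.of_forall fun x => ?_)
  · exact (Real.smoothTransition.continuous.comp
      (continuous_const.mul hψ)).aestronglyMeasurable.mul hg.aestronglyMeasurable
  · rw [norm_mul, Real.norm_of_nonneg (Real.smoothTransition.nonneg _)]
    exact mul_le_of_le_one_left (norm_nonneg _) (Real.smoothTransition.le_one _)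
  · by_cases hx : 0 < ψ x
    · rw [indicator_of_mem (by exact hx)]
      refine tendsto_const_nhds.congr' ?_
      filter_upwards [eventually_one_le_natCast_mul hx] with n hn
      rw [Real.smoothTransition.one_of_one_le hn, one_mul]
    · rw [indicator_of_notMem (by exact hx)]
      refine tendsto_const_nhds.congr fun n => ?_
      rw [Real.smoothTransition.zero_of_nonpos
        (mul_nonpos_of_nonneg_of_nonpos n.cast_nonneg (not_lt.1 hx)), zero_mul]

lemma tendsto_integral_deriv_smoothTransition_mul [IsFiniteMeasureOnCompacts μ] {ψ g : X → ℝ}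
    (hψ : Continuous ψ) (hg : Continuous g) (hgc : HasCompactSupport g) {C : ℝ}
    (hC : ∀ y, 0 < ψ y → |g y| ≤ C * ψ y) :
    Tendsto (fun n : ℕ => ∫ x, deriv Real.smoothTransition (n * ψ x) * n * g x ∂μ) atTop
      (𝓝 0) := by
  obtain ⟨M, hM⟩ := exists_abs_deriv_smoothTransition_le
  have hbound : ∀ (n : ℕ) x, |deriv Real.smoothTransition (n * ψ x) * n * g x| ≤ M * |C| := by
    intro n x
    by_cases hx : (n * ψ x) ∈ Ioo (0 : ℝ) 1
    · have hψx : 0 < ψ x := pos_of_mul_pos_right hx.1 n.cast_nonneg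
      rw [mul_assoc, abs_mul, abs_mul, Nat.abs_cast]
      refine mul_le_mul (hM _) ?_ (by positivity) ((abs_nonneg _).trans (hM 0))
      calc (n : ℝ) * |g x| ≤ n * (|C| * ψ x) := by
            gcongr
            exact (hC x hψx).trans (by gcongr; exact le_abs_self C)
        _ = |C| * (n * ψ x) := by ring
        _ ≤ |C| := mul_le_of_le_one_right (abs_nonneg _) hx.2.le
    · rw [deriv_smoothTransition_eq_zero hx, zero_mul, zero_mul, abs_zero]
      exact mul_nonneg ((abs_nonneg _).trans (hM 0)) (abs_nonneg C)
  have hη : Continuous (deriv Real.smoothTransition) :=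
    (Real.smoothTransition.contDiff (n := 1)).continuous_deriv le_rfl
  rw [← integral_zero X ℝ (μ := μ)]
  refine tendsto_integral_of_dominated_convergence ((tsupport g).indicator fun _ => M * |C|)
    (fun n => (((hη.comp (continuous_const.mul hψ)).mul
      continuous_const).mul hg).aestronglyMeasurable) ?_
    (fun n => Eventually.of_forall fun x => ?_) (Eventually.of_forall fun x => ?_)
  · exact (integrable_indicator_iff (isClosed_tsupport g).measurableSet).2
      (integrableOn_const hgc.isCompact.measure_lt_top.ne)
  · by_cases hx : x ∈ tsupport g
    · rw [indicator_of_mem hx]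
      exact hbound n x
    · simp [indicator_of_notMem hx, image_eq_zero_of_notMem_tsupport hx]
  · refine tendsto_const_nhds.congr' ?_
    by_cases hx : 0 < ψ x
    · filter_upwards [eventually_one_le_natCast_mul hx] with n hn
      rw [deriv_smoothTransition_eq_zero fun h => h.2.not_ge hn, zero_mul, zero_mul]
    · refine Eventually.of_forall fun n => ?_
      have h : n * ψ x ∉ Ioo (0 : ℝ) 1 := fun h => hx (pos_of_mul_pos_right h.1 n.cast_nonneg)
      simp only [deriv_smoothTransition_eq_zero h, zero_mul]

end SmoothTransition

section Divergence

variable {E : Type*} [NormedAddCommGroup E] [NormedSpace ℝ E]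

/-- The divergence of a vector field, defined without coordinates as the trace of its derivative;
in the plane it is `∂₁F₁ + ∂₂F₂`, see `divergence_eq_add`. -/
noncomputable def divergence (F : E → E) (x : E) : ℝ :=
  LinearMap.trace ℝ E (fderiv ℝ F x : E →ₗ[ℝ] E)

lemma divergence_congr {F F' : E → E} {x : E} (h : F =ᶠ[𝓝 x] F') :
    divergence F x = divergence F' x := by
  rw [divergence, divergence, h.fderiv_eq]

lemma divergence_eq_zero_of_notMem_tsupport {F : E → E} {x : E} (h : x ∉ tsupport F) :
    divergence F x = 0 := by
  simp [divergence, fderiv_of_notMem_tsupport ℝ h]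

lemma hasCompactSupport_divergence {F : E → E} (h : HasCompactSupport F) :
    HasCompactSupport (divergence F) :=
  HasCompactSupport.intro h fun _ hx => divergence_eq_zero_of_notMem_tsupport hx

lemma divergence_add {F F' : E → E} {x : E} (hF : DifferentiableAt ℝ F x)
    (hF' : DifferentiableAt ℝ F' x) :
    divergence (F + F') x = divergence F x + divergence F' x := by
  simp [divergence, fderiv_add hF hF']

lemma divergence_sum {ι : Type*} {s : Finset ι} {F : ι → E → E} {x : E}
    (hF : ∀ i ∈ s, DifferentiableAt ℝ (F i) x) :
    divergence (∑ i ∈ s, F i) x = ∑ i ∈ s, divergence (F i) x := by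
  simp [divergence, fderiv_sum hF]

lemma divergence_eq_smul_add_one_sub_smul {f : E → ℝ} {F : E → E} {x : E}
    (hf : DifferentiableAt ℝ f x) (hF : DifferentiableAt ℝ F x) :
    divergence F x = divergence (f • F) x + divergence ((1 - f) • F) x := by
  have hf' : DifferentiableAt ℝ (1 - f) x := (differentiableAt_const (1 : ℝ)).sub hf
  rw [← divergence_add (hf.smul hF) (hf'.smul hF), ← add_smul, add_sub_cancel, one_smul]

variable [FiniteDimensional ℝ E]

lemma divergence_smul {f : E → ℝ} {F : E → E} {x : E} (hf : DifferentiableAt ℝ f x)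
    (hF : DifferentiableAt ℝ F x) :
    divergence (f • F) x = f x * divergence F x + fderiv ℝ f x (F x) := by
  have h : (fderiv ℝ (f • F) x : E →ₗ[ℝ] E) = f x • (fderiv ℝ F x : E →ₗ[ℝ] E)
      + (fderiv ℝ f x : E →ₗ[ℝ] ℝ).smulRight (F x) := by
    rw [fderiv_smul hf hF]
    rfl
  simp [divergence, h, LinearMap.trace_smulRight]

lemma continuousAt_divergence {F : E → E} {x : E} (h : ContDiffAt ℝ 1 F x) :
    ContinuousAt (divergence F) x :=
  (LinearMap.continuous_of_finiteDimensional
    (LinearMap.trace ℝ E ∘ₗ ContinuousLinearMap.coeLM ℝ)).continuousAt.comp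
      (h.fderiv_right (m := 0) le_rfl).continuousAt

lemma continuous_divergence {F : E → E} (h : ContDiff ℝ 1 F) : Continuous (divergence F) :=
  continuous_iff_continuousAt.2 fun _ => continuousAt_divergence h.contDiffAt

variable [MeasurableSpace E] [BorelSpace E] {μ : Measure E} [μ.IsAddHaarMeasure]

lemma integrable_divergence {F : E → E} (h : ContDiff ℝ 1 F) (hc : HasCompactSupport F) :
    Integrable (divergence F) μ :=
  (continuous_divergence h).integrable_of_hasCompactSupport (hasCompactSupport_divergence hc)

lemma integral_fderiv_apply_eq_zero {F : E → E} (h : ContDiff ℝ 1 F) (hc : HasCompactSupport F)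
    (v : E) : ∫ x, fderiv ℝ F x v ∂μ = 0 := by
  have hint : Integrable (fun x => fderiv ℝ F x v) μ :=
    ((h.continuous_fderiv one_ne_zero).clm_apply continuous_const).integrable_of_hasCompactSupport
      (hc.fderiv_apply ℝ v)
  simpa using integral_smul_fderiv_eq_neg_fderiv_smul_of_integrable (μ := μ) (𝕜 := ℝ)
    (f := fun _ => (1 : ℝ)) (g := F) (v := v) (by simp) (by simpa using hint)
    (by simpa using h.continuous.integrable_of_hasCompactSupport hc) (by simp)
    (fun x _ => h.differentiable one_ne_zero x)

lemma integral_divergence_eq_zero {F : E → E} (h : ContDiff ℝ 1 F) (hc : HasCompactSupport F) :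
    ∫ x, divergence F x ∂μ = 0 := by
  let b := Module.finBasis ℝ E
  have htr : ∀ x, divergence F x = ∑ i, (b.coord i).toContinuousLinearMap (fderiv ℝ F x (b i)) :=
    fun x => by
      simp [divergence, LinearMap.trace_eq_matrix_trace ℝ b, Matrix.trace,
        LinearMap.toMatrix_apply]
  have hint : ∀ i, Integrable (fun x => fderiv ℝ F x (b i)) μ := fun i =>
    ((h.continuous_fderiv one_ne_zero).clm_apply continuous_const).integrable_of_hasCompactSupport
      (hc.fderiv_apply ℝ (b i))
  simp_rw [htr]
  rw [integral_finsetSum _ fun i _ => ContinuousLinearMap.integrable_comp _ (hint i)]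
  refine Finset.sum_eq_zero fun i _ => ?_
  rw [ContinuousLinearMap.integral_comp_comm _ (hint i), integral_fderiv_apply_eq_zero h hc,
    map_zero]

/- The cut-offs `η (n ψ)` exhaust `{0 < ψ}`, and the terms `η' (n ψ) n dψ(F)` that they produce
are bounded since `dψ(F) = O(ψ)`. -/
lemma setIntegral_pos_divergence_eq_zero {F : E → E} {ψ : E → ℝ} (hF : ContDiff ℝ 1 F)
    (hc : HasCompactSupport F) (hψ : ContDiff ℝ 1 ψ) {C : ℝ}
    (hC : ∀ y, 0 < ψ y → |fderiv ℝ ψ y (F y)| ≤ C * ψ y) :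
    ∫ y in {y | 0 < ψ y}, divergence F y ∂μ = 0 := by
  have hη : ContDiff ℝ 1 Real.smoothTransition := Real.smoothTransition.contDiff (n := 1)
  have hcut : ∀ n : ℕ, ContDiff ℝ 1 fun y => Real.smoothTransition (n * ψ y) := fun n =>
    hη.comp (contDiff_const.mul hψ)
  have hderiv : ∀ (n : ℕ) x, fderiv ℝ (fun y => Real.smoothTransition (n * ψ y)) x (F x)
      = deriv Real.smoothTransition (n * ψ x) * n * fderiv ℝ ψ x (F x) := fun n x => by
    have h := (hη.differentiable one_ne_zero (n * ψ x)).hasDerivAt.comp_hasFDerivAt x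
      ((hψ.differentiable one_ne_zero x).hasFDerivAt.const_mul (n : ℝ))
    have h' : fderiv ℝ (fun y => Real.smoothTransition (n * ψ y)) x = _ := h.fderiv
    rw [h']
    simp [mul_assoc]
  have hgc : Continuous fun x => fderiv ℝ ψ x (F x) :=
    (hψ.continuous_fderiv one_ne_zero).clm_apply hF.continuous
  have hgs : HasCompactSupport fun x => fderiv ℝ ψ x (F x) :=
    HasCompactSupport.intro hc fun x hx => by simp [image_eq_zero_of_notMem_tsupport hx]
  have hparts : ∀ n : ℕ, -∫ x, deriv Real.smoothTransition (n * ψ x) * n * fderiv ℝ ψ x (F x) ∂μ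
      = ∫ x, Real.smoothTransition (n * ψ x) * divergence F x ∂μ := by
    intro n
    have hzero := integral_divergence_eq_zero (μ := μ) ((hcut n).smul hF) hc.smul_left
    simp_rw [divergence_smul ((hcut n).differentiable one_ne_zero _)
      (hF.differentiable one_ne_zero _), ← hderiv] at hzero ⊢
    rw [integral_add] at hzero
    · linarith
    · exact ((hcut n).continuous.mul (continuous_divergence hF)).integrable_of_hasCompactSupport
        (hasCompactSupport_divergence hc).mul_left
    · refine (((hcut n).continuous_fderiv one_ne_zero).clm_apply
        hF.continuous).integrable_of_hasCompactSupport (HasCompactSupport.intro hc fun x hx => ?_)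
      simp [image_eq_zero_of_notMem_tsupport hx]
  have hlim := (tendsto_integral_deriv_smoothTransition_mul (μ := μ) hψ.continuous hgc hgs hC).neg
  rw [neg_zero] at hlim
  exact tendsto_nhds_unique
    (tendsto_integral_smoothTransition_mul hψ.continuous (integrable_divergence hF hc))
    (hlim.congr hparts)

end Divergence


section DefiningFunction

lemma exists_dist_le_mul_dist_of_hasStrictFDerivAt {E F : Type*} [NormedAddCommGroup E]
    [NormedSpace ℝ E] [CompleteSpace E] [NormedAddCommGroup F] [NormedSpace ℝ F] [CompleteSpace F]
    {f : E → F} {f' : E →L[ℝ] F} {a : E} (hf : HasStrictFDerivAt f f' a) (hf' : f'.range = ⊤) :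
    ∃ C, ∀ᶠ y in 𝓝 a, ∃ z, f z = f a ∧ dist z y ≤ C * dist (f a) (f y) := by
  let R := f'.nonlinearRightInverseOfSurjective hf'
  have hR : (0 : ℝ) < R.nnnorm := f'.nonlinearRightInverseOfSurjective_nnnorm_pos hf'
  obtain ⟨s, hs, happrox⟩ := hf.approximates_deriv_on_nhds (c := R.nnnorm⁻¹ / 2)
    (Or.inr (by simpa using hR))
  obtain ⟨r, hr, hrs⟩ := Metric.mem_nhds_iff.1 hs
  have hsmall : ∀ᶠ y in 𝓝 a, 2 * R.nnnorm * dist (f a) (f y) < r / 2 := by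
    have h : ContinuousAt (fun y => 2 * R.nnnorm * dist (f a) (f y)) a :=
      (continuousAt_const.dist hf.continuousAt).const_mul _
    exact h.eventually_lt_const (by simpa using half_pos hr)
  refine ⟨2 * R.nnnorm, ?_⟩
  filter_upwards [hsmall, Metric.ball_mem_nhds a (half_pos hr)] with y hy hya
  have hball : Metric.closedBall y (2 * R.nnnorm * dist (f a) (f y)) ⊆ s := fun z hz =>
    hrs ((dist_triangle z y a).trans_lt (by
      have hz' := Metric.mem_closedBall.1 hz
      have hya' := Metric.mem_ball.1 hya
      linarith))
  obtain ⟨z, hz, hfz⟩ := happrox.surjOn_closedBall_of_nonlinearRightInverse R (by positivity) hball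
    (show f a ∈ _ by
      rw [Metric.mem_closedBall]
      apply le_of_eq
      push_cast
      field_simp
      ring)
  exact ⟨z, hfz, hz⟩

variable {S : Set (ℝ × ℝ)} {x : ℝ × ℝ} {ψ : ℝ × ℝ → ℝ}

lemma IsDefiningFunction.hasStrictFDerivAt (h : IsDefiningFunction S x ψ) :
    HasStrictFDerivAt ψ (fderiv ℝ ψ x) x :=
  h.1.contDiffAt.hasStrictFDerivAt (by simp)

lemma IsDefiningFunction.range_fderiv (h : IsDefiningFunction S x ψ) :
    (fderiv ℝ ψ x).range = ⊤ :=
  LinearMap.range_eq_top.2 (LinearMap.surjective fun h0 =>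
    h.2.1 (ContinuousLinearMap.coe_injective h0))

lemma IsDefiningFunction.map_nhds_eq (h : IsDefiningFunction S x ψ) :
    map ψ (𝓝 x) = 𝓝 (ψ x) :=
  h.hasStrictFDerivAt.map_nhds_eq_of_surj h.range_fderiv

lemma IsDefiningFunction.mem_closure_iff (h : IsDefiningFunction S x ψ) :
    x ∈ closure S ↔ ψ x ≤ 0 := by
  rw [mem_closure_iff_frequently, frequently_congr h.2.2,
    ← frequently_map (m := ψ) (P := (· < 0)), h.map_nhds_eq]
  exact (mem_closure_iff_frequently (s := Iio 0)).symm.trans (by rw [closure_Iio, mem_Iic])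

lemma IsDefiningFunction.mem_interior_iff (h : IsDefiningFunction S x ψ) :
    x ∈ interior S ↔ ψ x < 0 := by
  rw [mem_interior_iff_mem_nhds, ← eventually_mem_set, eventually_congr h.2.2,
    ← eventually_map (m := ψ) (P := (· < 0)), h.map_nhds_eq]
  exact (mem_interior_iff_mem_nhds (s := Iio 0)).symm.trans (by rw [interior_Iio, mem_Iio])

lemma IsDefiningFunction.mem_frontier_iff (h : IsDefiningFunction S x ψ) :
    x ∈ frontier S ↔ ψ x = 0 := by
  rw [frontier, Set.mem_sdiff, h.mem_closure_iff, h.mem_interior_iff, not_lt]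
  exact antisymm_iff

lemma IsDefiningFunction.eventually (h : IsDefiningFunction S x ψ) :
    ∀ᶠ y in 𝓝 x, IsDefiningFunction S y ψ := by
  filter_upwards [h.2.2.eventually_nhds,
    (h.1.continuous_fderiv (by simp)).continuousAt.eventually_ne h.2.1] with y hy hy'
  exact ⟨h.1, hy', hy⟩

lemma IsDefiningFunction.exists_abs_le_mul (h : IsDefiningFunction S x ψ) (hx : x ∈ frontier S)
    {g : ℝ × ℝ → ℝ} (hg : ContDiffAt ℝ 1 g x) (hg0 : ∀ᶠ y in 𝓝 x, y ∈ frontier S → g y = 0) :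
    ∃ C, ∀ᶠ y in 𝓝 x, 0 < ψ y → |g y| ≤ C * ψ y := by
  have hψx : ψ x = 0 := h.mem_frontier_iff.1 hx
  obtain ⟨C, hC⟩ := exists_dist_le_mul_dist_of_hasStrictFDerivAt h.hasStrictFDerivAt h.range_fderiv
  obtain ⟨K, t, ht, hL⟩ := hg.exists_lipschitzOnWith
  have hnear : ∀ᶠ z in 𝓝 x, z ∈ t ∧ (ψ z = 0 → g z = 0) := by
    filter_upwards [ht, hg0, h.eventually] with z hzt hz hz'
    exact ⟨hzt, fun h0 => hz (hz'.mem_frontier_iff.2 h0)⟩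
  obtain ⟨r, hr, hball⟩ := Metric.eventually_nhds_iff_ball.1 hnear
  have hsmall : ∀ᶠ y in 𝓝 x, C * dist (ψ x) (ψ y) < r / 2 := by
    have hcont : ContinuousAt (fun y => C * dist (ψ x) (ψ y)) x :=
      (continuousAt_const.dist h.1.continuous.continuousAt).const_mul _
    exact hcont.eventually_lt_const (by simpa using half_pos hr)
  refine ⟨K * C, ?_⟩
  filter_upwards [hC, hsmall, Metric.ball_mem_nhds x (half_pos hr)] with y hy hys hyr hpos
  obtain ⟨z, hzψ, hzy⟩ := hy
  have hyb : y ∈ Metric.ball x r := Metric.ball_subset_ball (half_le_self hr.le) hyr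
  have hzb : z ∈ Metric.ball x r := by
    rw [Metric.mem_ball] at hyr ⊢
    linarith [dist_triangle z y x]
  have hgz : g z = 0 := (hball z hzb).2 (hzψ.trans hψx)
  have hdist : dist (ψ x) (ψ y) = ψ y := by
    rw [hψx, Real.dist_eq, zero_sub, abs_neg, abs_of_pos hpos]
  calc |g y| = dist (g y) (g z) := by rw [hgz, Real.dist_eq, sub_zero]
    _ ≤ K * dist y z := hL.dist_le_mul y (hball y hyb).1 z (hball z hzb).1
    _ ≤ K * (C * ψ y) := by
        rw [dist_comm, ← hdist]
        gcongr
    _ = K * C * ψ y := (mul_assoc _ _ _).symm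

end DefiningFunction


section Tangential

/-- The boundary of the holes `H` is smooth inside `O`, and there the field `F` is tangential
to it. -/
def IsTangential (H O : Set (ℝ × ℝ)) (F : ℝ × ℝ → ℝ × ℝ) : Prop :=
  ∀ x ∈ frontier H, x ∈ O → (∃ ψ, IsDefiningFunction H x ψ) ∧
    ∀ ψ, IsDefiningFunction H x ψ → fderiv ℝ ψ x (F x) = 0

variable {H O : Set (ℝ × ℝ)} {F : ℝ × ℝ → ℝ × ℝ} {x : ℝ × ℝ}

lemma IsTangential.smul (h : IsTangential H O F) (f : ℝ × ℝ → ℝ) : IsTangential H O (f • F) :=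
  fun x hx hxO => ⟨(h x hx hxO).1, fun ψ hψ => by
    rw [Pi.smul_apply', map_smul, (h x hx hxO).2 ψ hψ, smul_zero]⟩

lemma IsTangential.exists_abs_fderiv_le_mul (h : IsTangential H O F) (hO : O ∈ 𝓝 x)
    (hF : ContDiffAt ℝ 1 F x) (hx : x ∉ interior H) :
    ∃ (ψ : ℝ × ℝ → ℝ) (C : ℝ), ContDiff ℝ 1 ψ ∧ ∀ᶠ y in 𝓝 x,
      (y ∈ closure H ↔ ψ y ≤ 0) ∧ (0 < ψ y → |fderiv ℝ ψ y (F y)| ≤ C * ψ y) := by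
  by_cases hxc : x ∈ closure H
  · have hxf : x ∈ frontier H := ⟨hxc, hx⟩
    obtain ⟨ψ, hψ⟩ := (h x hxf (mem_of_mem_nhds hO)).1
    have hflux : ContDiffAt ℝ 1 (fun y => fderiv ℝ ψ y (F y)) x :=
      (hψ.1.contDiffAt.fderiv_right (n := ∞) (by decide)).clm_apply hF
    obtain ⟨C, hC⟩ := hψ.exists_abs_le_mul hxf hflux (by
      filter_upwards [hO, hψ.eventually] with y hyO hy hyf
      exact (h y hyf hyO).2 ψ hy)
    refine ⟨ψ, C, hψ.1.of_le (by simp), ?_⟩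
    filter_upwards [hC, hψ.eventually] with y hy hyψ
    exact ⟨hyψ.mem_closure_iff, hy⟩
  · refine ⟨fun _ => 1, 0, contDiff_const, ?_⟩
    filter_upwards [isClosed_closure.isOpen_compl.mem_nhds hxc] with y hy
    simp [show y ∉ closure H from hy]

lemma contDiff_smul_of_tsupport_subset {φ : ℝ × ℝ → ℝ} (hφ : ContDiff ℝ 1 φ)
    (hF : ∀ y ∈ tsupport φ, ContDiffAt ℝ 1 F y) : ContDiff ℝ 1 (φ • F) := by
  refine contDiff_iff_contDiffAt.2 fun y => ?_
  by_cases hy : y ∈ tsupport φ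
  · exact hφ.contDiffAt.smul (hF y hy)
  · have hzero : φ • F =ᶠ[𝓝 y] fun _ => 0 := by
      filter_upwards [notMem_tsupport_iff_eventuallyEq.1 hy] with z hz
      simp [hz]
    exact contDiffAt_const.congr_of_eventuallyEq hzero

lemma setIntegral_divergence_smul_eq_zero {φ ψ : ℝ × ℝ → ℝ} {C : ℝ} (hc : HasCompactSupport F)
    (hF : ∀ y ∈ tsupport φ, ContDiffAt ℝ 1 F y) (hφ : ContDiff ℝ 1 φ) (hφ1 : ∀ y, |φ y| ≤ 1)
    (hψ : ContDiff ℝ 1 ψ) (hH : ∀ y ∈ tsupport φ, y ∈ closure H ↔ ψ y ≤ 0)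
    (hC : ∀ y ∈ tsupport φ, 0 < ψ y → |fderiv ℝ ψ y (F y)| ≤ C * ψ y) :
    ∫ y in (closure H)ᶜ, divergence (φ • F) y = 0 := by
  have hbound : ∀ y, 0 < ψ y → |fderiv ℝ ψ y ((φ • F) y)| ≤ |C| * ψ y := by
    intro y hy
    by_cases hys : y ∈ tsupport φ
    · rw [Pi.smul_apply', map_smul, smul_eq_mul, abs_mul]
      calc |φ y| * |fderiv ℝ ψ y (F y)| ≤ 1 * (C * ψ y) := by
            gcongr
            exacts [hφ1 y, hC y hys hy]
        _ ≤ |C| * ψ y := by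
            rw [one_mul]
            gcongr
            exact le_abs_self C
    · rw [Pi.smul_apply', image_eq_zero_of_notMem_tsupport hys, zero_smul, map_zero, abs_zero]
      positivity
  rw [← setIntegral_pos_divergence_eq_zero (μ := volume) (contDiff_smul_of_tsupport_subset hφ hF)
    (hc.smul_left (f := φ)) hψ hbound, ← integral_indicator isClosed_closure.measurableSet.compl,
    ← integral_indicator (isOpen_lt continuous_const hψ.continuous).measurableSet]
  refine integral_congr_ae (Eventually.of_forall fun y => ?_)
  by_cases hy : y ∈ tsupport φ
  · simp only [indicator, mem_compl_iff, hH y hy, not_le, mem_ofPred_eq]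
  · have hzero : divergence (φ • F) y = 0 := divergence_eq_zero_of_notMem_tsupport fun h =>
      hy (tsupport_smul_subset_left φ F h)
    simp only [indicator, hzero, ite_self]

lemma IsTangential.exists_setIntegral_divergence_smul_eq_zero (h : IsTangential H O F)
    (hc : HasCompactSupport F) (hO : O ∈ 𝓝 x) (hF : ContDiffAt ℝ 1 F x) (hx : x ∉ interior H) :
    ∃ U, IsOpen U ∧ x ∈ U ∧ ∀ φ : ℝ × ℝ → ℝ, ContDiff ℝ 1 φ → (∀ y, |φ y| ≤ 1) →
      tsupport φ ⊆ U → ContDiff ℝ 1 (φ • F) ∧ ∫ y in (closure H)ᶜ, divergence (φ • F) y = 0 := by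
  obtain ⟨ψ, C, hψ, hev⟩ := h.exists_abs_fderiv_le_mul hO hF hx
  obtain ⟨U, hU, hUo, hxU⟩ := eventually_nhds_iff.1 (hev.and (hF.eventually (by simp)))
  refine ⟨U, hUo, hxU, fun φ hφ hφ1 hs => ?_⟩
  have hFs : ∀ y ∈ tsupport φ, ContDiffAt ℝ 1 F y := fun y hy => (hU y (hs hy)).2
  exact ⟨contDiff_smul_of_tsupport_subset hφ hFs, setIntegral_divergence_smul_eq_zero hc hFs hφ hφ1
    hψ (fun y hy => (hU y (hs hy)).1.1) (fun y hy => (hU y (hs hy)).1.2)⟩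

lemma IsTangential.exists_finset_smooth_partition (h : IsTangential H O F)
    (hc : HasCompactSupport F) (hO : IsOpen O) (hs : tsupport F ⊆ O)
    (hF : ∀ x ∈ O, x ∉ interior H → ContDiffAt ℝ 1 F x) :
    ∃ (ι : Type) (t : Finset ι) (ρ : ι → ℝ × ℝ → ℝ),
      (∀ y ∈ tsupport F, y ∉ interior H → ∑ i ∈ t, ρ i y = 1) ∧
      ∀ i, ContDiff ℝ 1 (ρ i • F) ∧ ∫ y in (closure H)ᶜ, divergence (ρ i • F) y = 0 := by
  let s := tsupport F \ interior H
  have hsc : IsCompact s := hc.isCompact.diff isOpen_interior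
  choose U hUo hxU hU using fun x : s => h.exists_setIntegral_divergence_smul_eq_zero hc
    (hO.mem_nhds (hs x.2.1)) (hF x (hs x.2.1) x.2.2) x.2.2
  obtain ⟨ρ, hρ⟩ := SmoothPartitionOfUnity.exists_isSubordinate
    (modelWithCornersSelf ℝ (ℝ × ℝ)) hsc.isClosed U hUo
    fun x hx => mem_iUnion.2 ⟨⟨x, hx⟩, hxU _⟩
  have hfin := ρ.locallyFinite.finite_nonempty_inter_compact hsc
  have hsm : ∀ i, ContDiff ℝ 1 (ρ i) := fun i => (ρ i).contMDiff.contDiff.of_le (by simp)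
  refine ⟨s, hfin.toFinset, fun i => ρ i, fun y hy hyi => ?_, fun i => hU i (ρ i) (hsm i)
    (fun y => abs_le.2 ⟨by linarith [ρ.nonneg i y], ρ.le_one i y⟩) (hρ i)⟩
  rw [← ρ.sum_eq_one (⟨hy, hyi⟩ : y ∈ s)]
  refine (finsum_eq_sum_of_support_subset _ fun i hi => ?_).symm
  rw [Finite.coe_toFinset]
  exact ⟨y, hi, hy, hyi⟩

lemma IsTangential.integral_divergence_eq_zero (h : IsTangential H O F)
    (hc : HasCompactSupport F) (hO : IsOpen O) (hs : tsupport F ⊆ O)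
    (hF : ∀ x ∈ O, x ∉ interior H → ContDiffAt ℝ 1 F x) :
    IntegrableOn (divergence F) (closure H)ᶜ ∧ ∫ y in (closure H)ᶜ, divergence F y = 0 := by
  obtain ⟨ι, t, ρ, hsum, hloc⟩ := h.exists_finset_smooth_partition hc hO hs hF
  have hm : MeasurableSet (closure H)ᶜ := isClosed_closure.measurableSet.compl
  have heq : EqOn (fun y => ∑ i ∈ t, divergence (ρ i • F) y) (divergence F) (closure H)ᶜ := by
    intro y hy
    have hrep : ∑ i ∈ t, ρ i • F =ᶠ[𝓝 y] F := by
      filter_upwards [isClosed_closure.isOpen_compl.mem_nhds hy] with z hz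
      rw [Finset.sum_apply]
      simp only [Pi.smul_apply', ← Finset.sum_smul]
      by_cases hzs : z ∈ tsupport F
      · rw [hsum z hzs fun hi => hz (subset_closure (interior_subset hi)), one_smul]
      · rw [image_eq_zero_of_notMem_tsupport hzs, smul_zero]
    rw [← divergence_congr hrep]
    exact (divergence_sum fun i _ => (hloc i).1.differentiable one_ne_zero y).symm
  have hint : ∀ i ∈ t, IntegrableOn (divergence (ρ i • F)) (closure H)ᶜ := fun i _ =>
    (integrable_divergence (hloc i).1 (hc.smul_left (f := ρ i))).integrableOn
  refine ⟨IntegrableOn.congr_fun (integrable_finsetSum t hint) heq hm, ?_⟩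
  rw [← setIntegral_congr_fun hm heq, integral_finsetSum t hint]
  exact Finset.sum_eq_zero fun i _ => (hloc i).2

end Tangential


section ShearedRectangle

/-- The shear that maps vertical lines onto horizontal translates of the curve `ξ₁ = ell ξ₂`. -/
def shear (ell : ℝ → ℝ) (p : ℝ × ℝ) : ℝ × ℝ := (p.1 + ell p.2, p.2)

/-- The part of the closed band `0 ≤ ξ₂ ≤ 1` between the curve `ξ₁ = ell ξ₂` shifted by `a` and the
same curve shifted by `b`. -/
def shearedRect (ell : ℝ → ℝ) (a b : ℝ) : Set (ℝ × ℝ) :=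
  {x | x.1 - ell x.2 ∈ Icc a b ∧ x.2 ∈ Icc (0 : ℝ) 1}

/-- The open counterpart of `shearedRect`. -/
def openShearedRect (ell : ℝ → ℝ) (a b : ℝ) : Set (ℝ × ℝ) :=
  {x | x.1 - ell x.2 ∈ Ioo a b ∧ x.2 ∈ Ioo (0 : ℝ) 1}

/-- The field `F` in the coordinates that straighten the curve `ξ₁ = ell ξ₂`: its Piola transform
under `shear ell`. -/
noncomputable def straighten (ell : ℝ → ℝ) (F : ℝ × ℝ → ℝ × ℝ) (p : ℝ × ℝ) : ℝ × ℝ :=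
  ((F (shear ell p)).1 - deriv ell p.2 * (F (shear ell p)).2, (F (shear ell p)).2)

/-- The flux of `F` through the part in the band `0 < ξ₂ < 1` of the curve `ξ₁ = ell ξ₂` shifted
by `a`. -/
noncomputable def flux (ell : ℝ → ℝ) (F : ℝ × ℝ → ℝ × ℝ) (a : ℝ) : ℝ :=
  ∫ t in (0 : ℝ)..1, (straighten ell F (a, t)).1

variable {ell : ℝ → ℝ} {a b : ℝ} {F : ℝ × ℝ → ℝ × ℝ}

lemma openShearedRect_subset : openShearedRect ell a b ⊆ shearedRect ell a b :=
  fun _ h => ⟨Ioo_subset_Icc_self h.1, Ioo_subset_Icc_self h.2⟩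

lemma preimage_shear_shearedRect :
    shear ell ⁻¹' shearedRect ell a b = Icc a b ×ˢ Icc (0 : ℝ) 1 := by
  ext p
  simp only [shear, shearedRect, mem_preimage, mem_ofPred_eq, add_sub_cancel_right, mem_prod]

lemma shear_mem_shearedRect {p : ℝ × ℝ} (hp : p ∈ Icc a b ×ˢ Icc (0 : ℝ) 1) :
    shear ell p ∈ shearedRect ell a b :=
  preimage_shear_shearedRect.symm.subset hp

lemma image_shear : shear ell '' Icc a b ×ˢ Icc (0 : ℝ) 1 = shearedRect ell a b := by
  rw [← preimage_shear_shearedRect]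
  exact image_preimage_eq _ fun x => ⟨(x.1 - ell x.2, x.2), by simp [shear]⟩

lemma continuous_shear (hell : Continuous ell) : Continuous (shear ell) := by
  unfold shear
  fun_prop

lemma isCompact_shearedRect (hell : Continuous ell) : IsCompact (shearedRect ell a b) :=
  image_shear ▸ (isCompact_Icc.prod isCompact_Icc).image (continuous_shear hell)

lemma isOpen_openShearedRect (hell : Continuous ell) : IsOpen (openShearedRect ell a b) :=
  (isOpen_Ioo.preimage (by fun_prop : Continuous fun x : ℝ × ℝ => x.1 - ell x.2)).inter
    (isOpen_Ioo.preimage continuous_snd)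

lemma measurePreserving_shear (hell : Continuous ell) : MeasurePreserving (shear ell) := by
  have h : MeasurePreserving fun p : ℝ × ℝ => (p.1, p.2 + ell p.1) :=
    (MeasurePreserving.id volume).skew_product (g := fun t s => s + ell t)
      (by fun_prop)
      (Eventually.of_forall fun t => (measurePreserving_add_right volume (ell t)).map_eq)
  exact (Measure.measurePreserving_swap.comp h).comp Measure.measurePreserving_swap

lemma measurableEmbedding_shear (hell : Continuous ell) : MeasurableEmbedding (shear ell) :=
  (continuous_shear hell).measurableEmbedding fun p q h => by
    have h2 : p.2 = q.2 := (Prod.ext_iff.1 h).2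
    have h1 : p.1 + ell p.2 = q.1 + ell q.2 := (Prod.ext_iff.1 h).1
    rw [h2, add_left_inj] at h1
    exact Prod.ext h1 h2

lemma setIntegral_shearedRect (hell : Continuous ell) (f : ℝ × ℝ → ℝ) :
    ∫ x in shearedRect ell a b, f x = ∫ p in Icc a b ×ˢ Icc (0 : ℝ) 1, f (shear ell p) := by
  rw [← (measurePreserving_shear hell).setIntegral_preimage_emb (measurableEmbedding_shear hell),
    preimage_shear_shearedRect]

lemma volume_shearedRect (hell : Continuous ell) :
    volume (shearedRect ell a b) = ENNReal.ofReal (b - a) := by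
  rw [← (measurePreserving_shear hell).measure_preimage
    (isCompact_shearedRect hell).measurableSet.nullMeasurableSet, preimage_shear_shearedRect,
    Measure.volume_eq_prod, Measure.prod_prod]
  simp

lemma map_eq_smul_add_smul {V : Type*} [AddCommGroup V] [Module ℝ V] [TopologicalSpace V]
    (L : ℝ × ℝ →L[ℝ] V) (v : ℝ × ℝ) :
    L v = v.1 • L (1, 0) + v.2 • L (0, 1) := by
  rw [← map_smul, ← map_smul, ← map_add]
  simp

lemma divergence_eq_add (F : ℝ × ℝ → ℝ × ℝ) (x : ℝ × ℝ) :
    divergence F x = (fderiv ℝ F x (1, 0)).1 + (fderiv ℝ F x (0, 1)).2 := by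
  simp [divergence, LinearMap.trace_eq_matrix_trace ℝ (Module.Basis.finTwoProd ℝ), Matrix.trace,
    LinearMap.toMatrix_apply]

lemma hasFDerivAt_shear (hell : ContDiff ℝ 1 ell) (p : ℝ × ℝ) :
    HasFDerivAt (shear ell) ((ContinuousLinearMap.fst ℝ ℝ ℝ
      + deriv ell p.2 • ContinuousLinearMap.snd ℝ ℝ ℝ).prod (ContinuousLinearMap.snd ℝ ℝ ℝ)) p :=
  (hasFDerivAt_fst.add ((hell.differentiable one_ne_zero p.2).hasDerivAt.comp_hasFDerivAt p
    hasFDerivAt_snd)).prodMk hasFDerivAt_snd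

lemma contDiffAt_straighten (hell : ContDiff ℝ 2 ell) {p : ℝ × ℝ}
    (hF : ContDiffAt ℝ 1 F (shear ell p)) : ContDiffAt ℝ 1 (straighten ell F) p := by
  have hell' : ContDiff ℝ 1 (deriv ell) := hell.deriv'
  have hshear : ContDiff ℝ 1 (shear ell) :=
    (contDiff_fst.add ((hell.of_le one_le_two).comp contDiff_snd)).prodMk contDiff_snd
  have hcomp : ContDiffAt ℝ 1 (fun q => F (shear ell q)) p := hF.comp p hshear.contDiffAt
  exact (hcomp.fst.sub ((hell'.comp contDiff_snd).contDiffAt.mul hcomp.snd)).prodMk hcomp.snd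

lemma divergence_straighten (hell : ContDiff ℝ 2 ell) {p : ℝ × ℝ}
    (hF : DifferentiableAt ℝ F (shear ell p)) :
    divergence (straighten ell F) p = divergence F (shear ell p) := by
  have hcomp := hF.hasFDerivAt.comp p (hasFDerivAt_shear (hell.of_le one_le_two) p)
  have hell' : HasFDerivAt (fun q : ℝ × ℝ => deriv ell q.2)
      (deriv (deriv ell) p.2 • ContinuousLinearMap.snd ℝ ℝ ℝ) p :=
    (hell.deriv'.differentiable one_ne_zero p.2).hasDerivAt.comp_hasFDerivAt p hasFDerivAt_snd
  have hder : HasFDerivAt (straighten ell F) _ p :=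
    (hcomp.fst.sub (hell'.mul hcomp.snd)).prodMk hcomp.snd
  rw [divergence_eq_add, divergence_eq_add, hder.fderiv]
  simp [map_eq_smul_add_smul _ (deriv ell p.2, (1 : ℝ))]
  ring

lemma setIntegral_divergence_rect (hab : a ≤ b)
    (hF : ∀ p ∈ Icc a b ×ˢ Icc (0 : ℝ) 1, ContDiffAt ℝ 1 F p)
    (hper : ∀ s ∈ Icc a b, (F (s, 1)).2 = (F (s, 0)).2) :
    ∫ p in Icc a b ×ˢ Icc (0 : ℝ) 1, divergence F p
      = (∫ t in (0 : ℝ)..1, (F (b, t)).1) - ∫ t in (0 : ℝ)..1, (F (a, t)).1 := by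
  have hder : ∀ p ∈ Icc a b ×ˢ Icc (0 : ℝ) 1, HasFDerivAt F (fderiv ℝ F p) p := fun p hp =>
    ((hF p hp).differentiableAt one_ne_zero).hasFDerivAt
  have hint : IntegrableOn (divergence F) (Icc a b ×ˢ Icc (0 : ℝ) 1) :=
    ContinuousOn.integrableOn_compact (isCompact_Icc.prod isCompact_Icc) fun p hp =>
      (continuousAt_divergence (hF p hp)).continuousWithinAt
  have hsides : ∫ s in a..b, (F (s, 1)).2 = ∫ s in a..b, (F (s, 0)).2 :=
    intervalIntegral.integral_congr fun s hs => hper s (uIcc_of_le hab ▸ hs)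
  have hmem : ∀ p ∈ Ioo a b ×ˢ Ioo (0 : ℝ) 1, p ∈ Icc (a, (0 : ℝ)) (b, 1) := fun p hp =>
    ⟨⟨hp.1.1.le, hp.2.1.le⟩, ⟨hp.1.2.le, hp.2.2.le⟩⟩
  rw [Icc_prod_Icc] at hint hF hder ⊢
  simp only [funext (divergence_eq_add F)] at hint ⊢
  refine (integral_divergence_prod_Icc_of_hasFDerivAt_off_countable_of_le (fun p => (F p).1)
    (fun p => (F p).2) (fun p => (ContinuousLinearMap.fst ℝ ℝ ℝ).comp (fderiv ℝ F p))
    (fun p => (ContinuousLinearMap.snd ℝ ℝ ℝ).comp (fderiv ℝ F p)) (a, 0) (b, 1)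
    ⟨hab, zero_le_one⟩ ∅ countable_empty
    (fun p hp => (hF p hp).continuousAt.fst.continuousWithinAt)
    (fun p hp => (hF p hp).continuousAt.snd.continuousWithinAt)
    (fun p hp => (hder p (hmem p hp.1)).fst) (fun p hp => (hder p (hmem p hp.1)).snd) hint).trans ?_
  rw [hsides, sub_self, zero_add]

lemma setIntegral_divergence_shearedRect (hell : ContDiff ℝ 2 ell) (hab : a ≤ b)
    (hF : ∀ x ∈ shearedRect ell a b, ContDiffAt ℝ 1 F x)
    (hper : ∀ s ∈ Icc a b, (F (shear ell (s, 1))).2 = (F (shear ell (s, 0))).2) :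
    ∫ x in shearedRect ell a b, divergence F x = flux ell F b - flux ell F a := by
  have hFs : ∀ p ∈ Icc a b ×ˢ Icc (0 : ℝ) 1, ContDiffAt ℝ 1 F (shear ell p) := fun p hp =>
    hF _ (shear_mem_shearedRect hp)
  rw [setIntegral_shearedRect hell.continuous, flux, flux,
    ← setIntegral_divergence_rect hab (fun p hp => contDiffAt_straighten hell (hFs p hp)) hper]
  exact setIntegral_congr_fun (measurableSet_Icc.prod measurableSet_Icc) fun p hp =>
    (divergence_straighten hell ((hFs p hp).differentiableAt one_ne_zero)).symm

lemma exists_contDiff_cutoff {E : Type*} [NormedAddCommGroup E] [NormedSpace ℝ E]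
    [FiniteDimensional ℝ E] {K O : Set E} (hK : IsCompact K) (hO : IsOpen O) (hKO : K ⊆ O) :
    ∃ κ : E → ℝ, ContDiff ℝ 1 κ ∧ HasCompactSupport κ ∧ tsupport κ ⊆ O ∧
      ∀ x ∈ K, κ =ᶠ[𝓝 x] 1 := by
  obtain ⟨K', hK', hKK', hK'O⟩ := exists_compact_between hK hO hKO
  obtain ⟨κ, hκ1, hκ0, -⟩ := exists_contMDiffMap_one_nhds_of_subset_interior
    (modelWithCornersSelf ℝ E) (n := 1) hK.isClosed hKK'
  have hs : tsupport κ ⊆ K' :=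
    closure_minimal (fun x hx => not_imp_comm.1 (hκ0 x) hx) hK'.isClosed
  exact ⟨κ, κ.contMDiff.contDiff, hK'.of_isClosed_subset (isClosed_tsupport _) hs, hs.trans hK'O,
    eventually_nhdsSet_iff_forall.1 hκ1⟩

end ShearedRectangle


section PerforatedRectangle

variable {H : Set (ℝ × ℝ)} {ell : ℝ → ℝ} {a b : ℝ} {F : ℝ × ℝ → ℝ × ℝ}

lemma openShearedRect_inter_curve {c t : ℝ} (hc : c ∉ Ioo a b) :
    (c + ell t, t) ∉ openShearedRect ell a b := fun h => hc (by simpa using h.1)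

lemma flux_congr {F' : ℝ × ℝ → ℝ × ℝ} {c : ℝ}
    (h : ∀ t ∈ Icc (0 : ℝ) 1, F (c + ell t, t) = F' (c + ell t, t)) :
    flux ell F c = flux ell F' c := by
  refine intervalIntegral.integral_congr fun t ht => ?_
  simp only [straighten, shear, h t (uIcc_of_le (zero_le_one' ℝ) ▸ ht)]

lemma setIntegral_divergence_shearedRect_of_eventuallyEq_zero (hell : ContDiff ℝ 2 ell)
    (hab : a ≤ b) (h0 : ∀ x ∈ shearedRect ell a b, x ∈ closure H → F =ᶠ[𝓝 x] 0)
    (hF : ∀ x ∈ shearedRect ell a b, x ∉ interior H → ContDiffAt ℝ 1 F x)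
    (hper : ∀ s ∈ Icc a b, (F (shear ell (s, 1))).2 = (F (shear ell (s, 0))).2) :
    IntegrableOn (divergence F) (shearedRect ell a b \ closure H) ∧
      ∫ x in shearedRect ell a b \ closure H, divergence F x = flux ell F b - flux ell F a := by
  have hQ := isCompact_shearedRect (a := a) (b := b) hell.continuous
  have hsmooth : ∀ x ∈ shearedRect ell a b, ContDiffAt ℝ 1 F x := fun x hx => by
    by_cases hxH : x ∈ interior H
    · exact contDiffAt_const.congr_of_eventuallyEq
        (h0 x hx (subset_closure (interior_subset hxH)))
    · exact hF x hx hxH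
  have hint : IntegrableOn (divergence F) (shearedRect ell a b) :=
    ContinuousOn.integrableOn_compact hQ fun x hx =>
      (continuousAt_divergence (hsmooth x hx)).continuousWithinAt
  refine ⟨hint.mono_set sdiff_subset, ?_⟩
  rw [← setIntegral_divergence_shearedRect hell hab hsmooth hper]
  refine (setIntegral_eq_of_subset_of_forall_sdiff_eq_zero hQ.measurableSet sdiff_subset
    fun x hx => ?_).symm
  have hxH : x ∈ closure H := by_contra fun h => hx.2 ⟨hx.1, h⟩
  rw [divergence_congr (h0 x hx.1 hxH)]
  simp [divergence]

lemma IsTangential.setIntegral_divergence_shearedRect_eq_zero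
    (hT : IsTangential H (openShearedRect ell a b) F) (hell : Continuous ell)
    (hc : HasCompactSupport F) (hs : tsupport F ⊆ openShearedRect ell a b)
    (hF : ∀ x ∈ shearedRect ell a b, x ∉ interior H → ContDiffAt ℝ 1 F x) :
    IntegrableOn (divergence F) (shearedRect ell a b \ closure H) ∧
      ∫ x in shearedRect ell a b \ closure H, divergence F x = 0 := by
  obtain ⟨hint, hzero⟩ := hT.integral_divergence_eq_zero hc (isOpen_openShearedRect hell) hs
    fun x hx => hF x (openShearedRect_subset hx)
  refine ⟨hint.mono_set fun x hx => hx.2, hzero ▸ ?_⟩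
  refine (setIntegral_eq_of_subset_of_forall_sdiff_eq_zero isClosed_closure.measurableSet.compl
    (fun x hx => hx.2) fun x hx => divergence_eq_zero_of_notMem_tsupport fun h => ?_).symm
  exact hx.2 ⟨openShearedRect_subset (hs h), hx.1⟩

/- A cut-off `κ` splits `F` into `κ F`, supported near the holes, and `(1 - κ) F`, which vanishes
near the holes and agrees with `F` on the boundary of the sheared rectangle. -/
lemma IsTangential.setIntegral_divergence_shearedRect
    (hT : IsTangential H (openShearedRect ell a b) F) (hell : ContDiff ℝ 2 ell) (hab : a ≤ b)
    (hH : closure H ∩ shearedRect ell a b ⊆ openShearedRect ell a b)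
    (hF : ∀ x ∈ shearedRect ell a b, x ∉ interior H → ContDiffAt ℝ 1 F x)
    (hper : ∀ s ∈ Icc a b, (F (shear ell (s, 1))).2 = (F (shear ell (s, 0))).2) :
    ∫ x in shearedRect ell a b \ closure H, divergence F x = flux ell F b - flux ell F a := by
  have hQ := isCompact_shearedRect (a := a) (b := b) hell.continuous
  have hO := isOpen_openShearedRect (a := a) (b := b) hell.continuous
  obtain ⟨κ, hκ, hκc, hκO, hκ1⟩ :=
    exists_contDiff_cutoff (hQ.inter_left isClosed_closure) hO hH
  have hκ0 : ∀ x ∉ openShearedRect ell a b, (1 - κ) x = 1 := fun x hx => by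
    simp [image_eq_zero_of_notMem_tsupport fun h => hx (hκO h)]
  have hκF : ∀ x ∈ shearedRect ell a b, x ∉ interior H → ContDiffAt ℝ 1 (κ • F) x :=
    fun x hx hxH => hκ.contDiffAt.smul (hF x hx hxH)
  obtain ⟨hint, hinner⟩ := (hT.smul κ).setIntegral_divergence_shearedRect_eq_zero
    hell.continuous hκc.smul_right ((tsupport_smul_subset_left κ F).trans hκO) hκF
  obtain ⟨hint', houter⟩ := setIntegral_divergence_shearedRect_of_eventuallyEq_zero
    (F := (1 - κ) • F) hell hab (fun x hx hxH => by
      filter_upwards [hκ1 x ⟨hxH, hx⟩] with y hy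
      simp [hy])
    (fun x hx hxH => (contDiff_const.sub hκ).contDiffAt.smul (hF x hx hxH))
    (fun s hs => by
      rw [Pi.smul_apply', Pi.smul_apply', hκ0 _ fun h => lt_irrefl (1 : ℝ) h.2.2,
        hκ0 _ fun h => lt_irrefl (0 : ℝ) h.2.1, one_smul, one_smul, hper s hs])
  have hflux : ∀ c ∉ Ioo a b, flux ell ((1 - κ) • F) c = flux ell F c := fun c hc =>
    flux_congr fun t _ => by
      rw [Pi.smul_apply', hκ0 _ (openShearedRect_inter_curve hc), one_smul]
  rw [hflux b right_notMem_Ioo, hflux a left_notMem_Ioo] at houter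
  rw [← houter, ← zero_add (∫ x in _, divergence ((1 - κ) • F) x), ← hinner,
    ← integral_add hint hint']
  refine setIntegral_congr_fun (hQ.measurableSet.diff isClosed_closure.measurableSet)
    fun x hx => ?_
  have hxH : x ∉ interior H := fun h => hx.2 (subset_closure (interior_subset h))
  exact divergence_eq_smul_add_one_sub_smul (hκ.differentiable one_ne_zero x)
    ((hF x hx.1 hxH).differentiableAt one_ne_zero)

end PerforatedRectangle


section Solenoidal

variable {H : Set (ℝ × ℝ)} {ell : ℝ → ℝ} {a b : ℝ} {F : ℝ × ℝ → ℝ × ℝ}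

/-- `F` is a divergence-free field on the part of a sheared rectangle outside the holes `H`. It is
tangential to the boundaries of the holes, which do not meet the boundary of the rectangle, and
takes the same values at opposite points of the horizontal sides. -/
structure IsSolenoidal (H : Set (ℝ × ℝ)) (ell : ℝ → ℝ) (a b : ℝ) (F : ℝ × ℝ → ℝ × ℝ) :
    Prop where
  closure_inter_subset : closure H ∩ shearedRect ell a b ⊆ openShearedRect ell a b
  contDiffAt : ∀ x ∈ shearedRect ell a b, x ∉ interior H → ContDiffAt ℝ 1 F x
  isTangential : IsTangential H (openShearedRect ell a b) F
  divergence_eq_zero : ∀ x ∈ openShearedRect ell a b, x ∉ closure H → divergence F x = 0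
  periodic : ∀ s, F (s, 1) = F (s, 0)

lemma volume_openShearedRect (hell : Continuous ell) :
    volume (openShearedRect ell a b) = ENNReal.ofReal (b - a) := by
  have hpre : shear ell ⁻¹' openShearedRect ell a b = Ioo a b ×ˢ Ioo (0 : ℝ) 1 := by
    ext p
    simp only [shear, openShearedRect, mem_preimage, mem_ofPred_eq, add_sub_cancel_right, mem_prod]
  rw [← (measurePreserving_shear hell).measure_preimage
    (isOpen_openShearedRect hell).measurableSet.nullMeasurableSet, hpre, Measure.volume_eq_prod,
    Measure.prod_prod]
  simp

lemma openShearedRect_ae_eq (hell : Continuous ell) :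
    openShearedRect ell a b =ᵐ[volume] shearedRect ell a b := by
  refine ae_eq_of_subset_of_measure_ge openShearedRect_subset ?_
    (isOpen_openShearedRect hell).measurableSet.nullMeasurableSet
    (isCompact_shearedRect hell).measure_ne_top
  rw [volume_shearedRect hell, volume_openShearedRect hell]

lemma openShearedRect_diff_ae_eq (hell : Continuous ell) (S : Set (ℝ × ℝ)) :
    (openShearedRect ell a b \ S : Set (ℝ × ℝ)) =ᵐ[volume] (shearedRect ell a b \ S : Set _) :=
  (openShearedRect_ae_eq hell).diff (ae_eq_refl S)

lemma IsSolenoidal.setIntegral_fderiv_apply (hF : IsSolenoidal H ell a b F)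
    (hell : ContDiff ℝ 2 ell) (hell1 : ell 1 = ell 0) (hab : a ≤ b) {w : ℝ × ℝ → ℝ}
    (hw : ∀ x ∈ shearedRect ell a b, x ∉ interior H → ContDiffAt ℝ 1 w x)
    (hwper : ∀ s, w (s, 1) = w (s, 0)) :
    ∫ x in openShearedRect ell a b \ closure H, fderiv ℝ w x (F x)
      = flux ell (w • F) b - flux ell (w • F) a := by
  rw [← (hF.isTangential.smul w).setIntegral_divergence_shearedRect hell hab
    hF.closure_inter_subset (fun x hx hxH => (hw x hx hxH).smul (hF.contDiffAt x hx hxH))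
    (fun s _ => by simp only [shear, hell1, Pi.smul_apply', hwper, hF.periodic])]
  refine Eq.trans ?_ (setIntegral_congr_set (openShearedRect_diff_ae_eq hell.continuous _))
  refine setIntegral_congr_fun ((isOpen_openShearedRect hell.continuous).measurableSet.diff
    isClosed_closure.measurableSet) fun x hx => ?_
  have hxQ := openShearedRect_subset hx.1
  have hxH : x ∉ interior H := fun h => hx.2 (subset_closure (interior_subset h))
  rw [divergence_smul ((hw x hxQ hxH).differentiableAt one_ne_zero)
    ((hF.contDiffAt x hxQ hxH).differentiableAt one_ne_zero),
    hF.divergence_eq_zero x hx.1 hx.2, mul_zero, zero_add]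

lemma flux_smul_of_forall_eq {c r : ℝ} {w : ℝ × ℝ → ℝ} (hw : ∀ t, w (c + ell t, t) = r) :
    flux ell (w • F) c = r * flux ell F c := by
  rw [flux, flux, ← intervalIntegral.integral_const_mul]
  refine intervalIntegral.integral_congr fun t _ => ?_
  simp only [straighten, shear, Pi.smul_apply', hw, Prod.smul_fst, Prod.smul_snd, smul_eq_mul]
  ring

lemma IsSolenoidal.flux_eq (hF : IsSolenoidal H ell a b F) (hell : ContDiff ℝ 2 ell)
    (hell1 : ell 1 = ell 0) (hab : a ≤ b) : flux ell F b = flux ell F a := by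
  have h := hF.setIntegral_fderiv_apply (w := 1) hell hell1 hab
    (fun _ _ _ => contDiffAt_const) fun _ => rfl
  exact sub_eq_zero.1 (by simpa using h.symm)

end Solenoidal

section Decay

/-- The profile of the cut-off across a sheared rectangle of width one. -/
def bump (τ : ℝ) : ℝ := τ * (1 - τ)

/-- The primitive of `bump ^ 2` that vanishes at `0`. -/
noncomputable def bumpPrimitive (τ : ℝ) : ℝ := τ ^ 3 / 3 - τ ^ 4 / 2 + τ ^ 5 / 5

lemma hasDerivAt_bump (τ : ℝ) : HasDerivAt bump (1 - 2 * τ) τ :=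
  ((hasDerivAt_id τ).mul ((hasDerivAt_id τ).const_sub 1)).congr_deriv (by simp only [id]; ring)

lemma hasDerivAt_bumpPrimitive (τ : ℝ) : HasDerivAt bumpPrimitive (bump τ ^ 2) τ :=
  ((((hasDerivAt_pow 3 τ).div_const 3).sub ((hasDerivAt_pow 4 τ).div_const 2)).add
    ((hasDerivAt_pow 5 τ).div_const 5)).congr_deriv (by simp only [bump]; push_cast; ring)

lemma abs_bump_le_one {τ : ℝ} (h : τ ∈ Ioo (0 : ℝ) 1) : |bump τ| ≤ 1 := by
  rw [bump, abs_le]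
  constructor <;> nlinarith [h.1, h.2]

/-- The multiplier in the Caccioppoli estimate for `B`; it equals `0` on the left side of the
sheared rectangle of width one that starts at `a` and `s / 30` on the right side. -/
noncomputable def caccioppoliTest (ell : ℝ → ℝ) (a s : ℝ) (B : ℝ × ℝ → ℝ) (x : ℝ × ℝ) : ℝ :=
  s * bumpPrimitive (x.1 - ell x.2 - a) - bump (x.1 - ell x.2 - a) ^ 2 * B x

/-- The gradient of a function on the plane. -/
noncomputable def grad (u : ℝ × ℝ → ℝ) (x : ℝ × ℝ) : ℝ × ℝ := (d1 u x, d2 u x)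

variable {H : Set (ℝ × ℝ)} {ell : ℝ → ℝ} {a s : ℝ} {B : ℝ × ℝ → ℝ} {x : ℝ × ℝ}

lemma fderiv_apply_eq (u : ℝ × ℝ → ℝ) (x v : ℝ × ℝ) :
    fderiv ℝ u x v = d1 u x * v.1 + d2 u x * v.2 := by
  rw [map_eq_smul_add_smul, d1, d2, smul_eq_mul, smul_eq_mul, mul_comm v.1, mul_comm v.2]

lemma fderiv_caccioppoliTest_apply (hell : Differentiable ℝ ell) (hB : DifferentiableAt ℝ B x)
    (v : ℝ × ℝ) :
    fderiv ℝ (caccioppoliTest ell a s B) x v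
      = s * bump (x.1 - ell x.2 - a) ^ 2 * (v.1 - deriv ell x.2 * v.2)
        - (bump (x.1 - ell x.2 - a) ^ 2 * fderiv ℝ B x v
          + 2 * bump (x.1 - ell x.2 - a) * (1 - 2 * (x.1 - ell x.2 - a)) * B x
            * (v.1 - deriv ell x.2 * v.2)) := by
  have hT : HasFDerivAt (fun x : ℝ × ℝ => x.1 - ell x.2 - a)
      (ContinuousLinearMap.fst ℝ ℝ ℝ - deriv ell x.2 • ContinuousLinearMap.snd ℝ ℝ ℝ) x :=
    (hasFDerivAt_fst.sub ((hell x.2).hasDerivAt.comp_hasFDerivAt x hasFDerivAt_snd)).sub_const a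
  have hprim : HasFDerivAt (fun x : ℝ × ℝ => bumpPrimitive (x.1 - ell x.2 - a)) _ x :=
    (hasDerivAt_bumpPrimitive _).comp_hasFDerivAt x hT
  have hbump : HasFDerivAt (fun x : ℝ × ℝ => bump (x.1 - ell x.2 - a)) _ x :=
    (hasDerivAt_bump _).comp_hasFDerivAt x hT
  have h : HasFDerivAt (caccioppoliTest ell a s B) _ x :=
    (hprim.const_mul s).sub ((hbump.pow 2).mul hB.hasFDerivAt)
  rw [h.fderiv]
  simp
  ring

lemma caccioppoli_pointwise {χ χ' A g b C δ : ℝ} (hC : 0 < C) (hA : A ^ 2 ≤ C * g)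
    (hχ : |χ| ≤ 1) (hχ' : |χ'| ≤ 1) (hb : |b| ≤ δ) :
    s * χ ^ 2 * A - (χ ^ 2 * g + 2 * χ * χ' * b * A) ≤ C * (s ^ 2 / 2 + 2 * δ ^ 2) := by
  have hχ2 : χ ^ 2 ≤ 1 := (sq_le_one_iff_abs_le_one χ).2 hχ
  have hχb : (χ' * b) ^ 2 ≤ δ ^ 2 := by
    rw [← sq_abs, abs_mul]
    gcongr
    nlinarith [abs_nonneg χ', abs_nonneg b]
  have hflux : C * (s * A) ≤ C * (C * s ^ 2 / 2 + g / 2) := by nlinarith [sq_nonneg (C * s - A)]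
  have hcross : C * -(2 * χ * χ' * b * A) ≤ C * (χ ^ 2 * g / 2 + 2 * C * (χ' * b) ^ 2) := by
    nlinarith [sq_nonneg (χ * A + 2 * C * (χ' * b)), mul_le_mul_of_nonneg_left hA (sq_nonneg χ)]
  have hflux' := mul_le_mul_of_nonneg_left (le_of_mul_le_mul_left hflux hC) (sq_nonneg χ)
  have hcross' := le_of_mul_le_mul_left hcross hC
  have hs : χ ^ 2 * (C * s ^ 2 / 2) ≤ C * s ^ 2 / 2 := mul_le_of_le_one_left (by positivity) hχ2
  nlinarith [mul_le_mul_of_nonneg_left hχb hC.le]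

lemma setIntegral_le_mul_measureReal {α : Type*} [MeasurableSpace α] {μ : Measure α} {S : Set α}
    {f : α → ℝ} {K : ℝ} (hS : MeasurableSet S) (hμ : μ S ≠ ⊤) (hK : 0 ≤ K)
    (hf : ∀ x ∈ S, f x ≤ K) : ∫ x in S, f x ∂μ ≤ K * μ.real S := by
  by_cases hi : IntegrableOn f S μ
  · simpa [mul_comm] using setIntegral_mono_on hi (integrableOn_const hμ) hS hf
  · rw [integral_undef hi]
    positivity

lemma contDiffAt_caccioppoliTest (hell : ContDiff ℝ 1 ell) (hB : ContDiffAt ℝ 1 B x) :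
    ContDiffAt ℝ 1 (caccioppoliTest ell a s B) x := by
  have : ContDiffAt ℝ 1 (fun x : ℝ × ℝ => ell x.2) x :=
    (hell.comp contDiff_snd).contDiffAt
  unfold caccioppoliTest bump bumpPrimitive
  fun_prop

lemma fderiv_caccioppoliTest_grad_le (hell : Differentiable ℝ ell) (hB : DifferentiableAt ℝ B x)
    (hx : x.1 - ell x.2 ∈ Ioo a (a + 1)) {C δ : ℝ} (hC : 1 + deriv ell x.2 ^ 2 ≤ C)
    (hδ : |B x| ≤ δ) :
    fderiv ℝ (caccioppoliTest ell a s B) x (grad B x) ≤ C * (s ^ 2 / 2 + 2 * δ ^ 2) := by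
  have hτ : x.1 - ell x.2 - a ∈ Ioo (0 : ℝ) 1 := by
    constructor <;> linarith [hx.1, hx.2]
  have hgrad : fderiv ℝ B x (grad B x) = d1 B x ^ 2 + d2 B x ^ 2 := by
    rw [fderiv_apply_eq, grad]
    ring
  have hcauchy : (d1 B x - deriv ell x.2 * d2 B x) ^ 2
      ≤ (1 + deriv ell x.2 ^ 2) * (d1 B x ^ 2 + d2 B x ^ 2) := by
    nlinarith [sq_nonneg (deriv ell x.2 * d1 B x + d2 B x)]
  rw [fderiv_caccioppoliTest_apply hell hB, hgrad]
  refine caccioppoli_pointwise (by nlinarith [sq_nonneg (deriv ell x.2)])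
    (hcauchy.trans (by gcongr)) (abs_bump_le_one hτ) ?_ hδ
  rw [abs_le]
  constructor <;> linarith [hτ.1, hτ.2]

lemma IsSolenoidal.mul_flux_grad_le (hB : IsSolenoidal H ell a (a + 1) (grad B))
    (hBs : ∀ x ∈ shearedRect ell a (a + 1), x ∉ interior H → ContDiffAt ℝ 1 B x)
    (hBper : ∀ s, B (s, 1) = B (s, 0)) (hell : ContDiff ℝ 2 ell) (hell1 : ell 1 = ell 0) {C δ : ℝ}
    (hC : ∀ t ∈ Icc (0 : ℝ) 1, 1 + deriv ell t ^ 2 ≤ C)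
    (hBδ : ∀ x ∈ openShearedRect ell a (a + 1) \ closure H, |B x| ≤ δ) (s : ℝ) :
    s * flux ell (grad B) a ≤ 30 * (C * (s ^ 2 / 2 + 2 * δ ^ 2)) := by
  have hC0 : 0 < C := by nlinarith [hC 0 (by simp), sq_nonneg (deriv ell 0)]
  have hK : 0 ≤ C * (s ^ 2 / 2 + 2 * δ ^ 2) := by positivity
  have ha : a ≤ a + 1 := by linarith
  have hgreen := hB.setIntegral_fderiv_apply (w := caccioppoliTest ell a s B) hell hell1 ha
    (fun x hx hxH => contDiffAt_caccioppoliTest (hell.of_le one_le_two) (hBs x hx hxH))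
    fun r => by simp only [caccioppoliTest, hell1, hBper]
  have hright : ∀ t, caccioppoliTest ell a s B (a + 1 + ell t, t) = s / 30 := fun t => by
    simp [caccioppoliTest, bump, bumpPrimitive]
    ring
  have hleft : ∀ t, caccioppoliTest ell a s B (a + ell t, t) = 0 := fun t => by
    simp [caccioppoliTest, bump, bumpPrimitive]
  rw [flux_smul_of_forall_eq hright, flux_smul_of_forall_eq hleft, hB.flux_eq hell hell1 ha,
    zero_mul, sub_zero] at hgreen
  have hvol : volume (openShearedRect ell a (a + 1) \ closure H) ≤ 1 :=
    (measure_mono sdiff_subset).trans_eq (by simp [volume_openShearedRect hell.continuous])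
  have hle := setIntegral_le_mul_measureReal
    ((isOpen_openShearedRect hell.continuous).measurableSet.diff isClosed_closure.measurableSet)
    (hvol.trans_lt ENNReal.one_lt_top).ne hK fun x hx =>
      fderiv_caccioppoliTest_grad_le (s := s) (hell.differentiable two_ne_zero)
        ((hBs x (openShearedRect_subset hx.1) fun h =>
          hx.2 (subset_closure (interior_subset h))).differentiableAt one_ne_zero)
        hx.1.1 (hC x.2 (Ioo_subset_Icc_self hx.1.2)) (hBδ x hx)
  rw [hgreen] at hle
  have := hle.trans (mul_le_of_le_one_right hK (ENNReal.toReal_le_of_le_ofReal zero_le_one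
    (by simpa using hvol)))
  linarith

lemma IsSolenoidal.abs_flux_grad_le (hB : IsSolenoidal H ell a (a + 1) (grad B))
    (hBs : ∀ x ∈ shearedRect ell a (a + 1), x ∉ interior H → ContDiffAt ℝ 1 B x)
    (hBper : ∀ s, B (s, 1) = B (s, 0)) (hell : ContDiff ℝ 2 ell) (hell1 : ell 1 = ell 0) {C δ : ℝ}
    (hC : ∀ t ∈ Icc (0 : ℝ) 1, 1 + deriv ell t ^ 2 ≤ C) (hδ : 0 < δ)
    (hBδ : ∀ x ∈ openShearedRect ell a (a + 1) \ closure H, |B x| ≤ δ) :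
    |flux ell (grad B) a| ≤ 60 * C * δ := by
  have hle := hB.mul_flux_grad_le hBs hBper hell hell1 hC hBδ
  rw [abs_le]
  constructor
  · refine le_of_mul_le_mul_left ?_ (by positivity : 0 < 2 * δ)
    linarith [hle (-(2 * δ))]
  · refine le_of_mul_le_mul_left ?_ (by positivity : 0 < 2 * δ)
    linarith [hle (2 * δ)]

end Decay


section Shift

variable {S T : Set (ℝ × ℝ)} {x v : ℝ × ℝ} {ψ : ℝ × ℝ → ℝ}

lemma IsDefiningFunction.congr_set (h : IsDefiningFunction S x ψ)
    (hST : ∀ᶠ y in 𝓝 x, (y ∈ S ↔ y ∈ T)) : IsDefiningFunction T x ψ :=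
  ⟨h.1, h.2.1, by filter_upwards [hST, h.2.2] with y hy hψ using hy.symm.trans hψ⟩

lemma IsDefiningFunction.comp_add_right (h : IsDefiningFunction S (x + v) ψ) :
    IsDefiningFunction ((· + v) ⁻¹' S) x fun y => ψ (y + v) :=
  ⟨h.1.comp (contDiff_id.add contDiff_const), by rw [fderiv_comp_add_right]; exact h.2.1,
    ((continuous_add_const v).tendsto x).eventually h.2.2⟩

lemma IsUnitNormalInto.congr_set {ν : ℝ × ℝ} (h : IsUnitNormalInto S x ν)
    (hST : ∀ᶠ y in 𝓝 x, (y ∈ S ↔ y ∈ T)) : IsUnitNormalInto T x ν :=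
  ⟨h.1, h.2.imp fun _ hψ => ⟨hψ.1.congr_set hST, hψ.2⟩⟩

lemma IsUnitNormalInto.preimage_add_right {ν : ℝ × ℝ} (h : IsUnitNormalInto S (x + v) ν) :
    IsUnitNormalInto ((· + v) ⁻¹' S) x ν := by
  obtain ⟨hν, ψ, hψ, hgrad⟩ := h
  refine ⟨hν, _, hψ.comp_add_right, ?_⟩
  simpa only [d1, d2, fderiv_comp_add_right] using hgrad

lemma IsDefiningFunction.exists_isUnitNormalInto (h : IsDefiningFunction S x ψ) :
    ∃ ν t, IsUnitNormalInto S x ν ∧ d1 ψ x = -t * ν.1 ∧ d2 ψ x = -t * ν.2 := by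
  have hpos : 0 < d1 ψ x ^ 2 + d2 ψ x ^ 2 := by
    by_contra! hle
    have h1 : d1 ψ x = 0 := by nlinarith [sq_nonneg (d1 ψ x), sq_nonneg (d2 ψ x)]
    have h2 : d2 ψ x = 0 := by nlinarith [sq_nonneg (d1 ψ x), sq_nonneg (d2 ψ x)]
    exact h.2.1 (ContinuousLinearMap.ext fun v => by simp [fderiv_apply_eq, h1, h2])
  set t := √(d1 ψ x ^ 2 + d2 ψ x ^ 2)
  have ht : 0 < t := Real.sqrt_pos.2 hpos
  have ht2 : t ^ 2 = d1 ψ x ^ 2 + d2 ψ x ^ 2 := Real.sq_sqrt hpos.le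
  have hcoord : ∀ c : ℝ, c = -t * (-c / t) := fun c => by field_simp
  refine ⟨(-d1 ψ x / t, -d2 ψ x / t), t, ⟨?_, ψ, h, t, ht, hcoord _, hcoord _⟩, hcoord _, hcoord _⟩
  field_simp
  exact ht2.symm

lemma IsDefiningFunction.fderiv_eq_zero (h : IsDefiningFunction S x ψ)
    (hv : ∀ ν, IsUnitNormalInto S x ν → v.1 * ν.1 + v.2 * ν.2 = 0) : fderiv ℝ ψ x v = 0 := by
  obtain ⟨ν, t, hν, h1, h2⟩ := h.exists_isUnitNormalInto
  rw [fderiv_apply_eq, h1, h2]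
  linear_combination -t * hv ν hν

end Shift

section PeriodicHoles

variable {G S : Set (ℝ × ℝ)} {x : ℝ × ℝ}

lemma IsHoleSystem.isOpen (hG : IsHoleSystem G) : IsOpen G := by
  obtain ⟨m, D, hD, -, -, rfl⟩ := hG
  exact isOpen_iUnion fun i => (hD i).isOpen

lemma IsHoleSystem.closure_subset (hG : IsHoleSystem G) :
    closure G ⊆ Ioo (0 : ℝ) 1 ×ˢ Ioo (0 : ℝ) 1 := by
  obtain ⟨m, D, -, -, hsub, rfl⟩ := hG
  rw [closure_iUnion_of_finite]
  exact iUnion_subset hsub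

lemma IsHoleSystem.exists_isDefiningFunction (hG : IsHoleSystem G) (hx : x ∈ frontier G) :
    ∃ ψ, IsDefiningFunction G x ψ := by
  have hxG : x ∉ G := by
    rw [hG.isOpen.frontier_eq] at hx
    exact hx.2
  obtain ⟨m, D, hD, hdisj, -, rfl⟩ := hG
  obtain ⟨i, hi⟩ : ∃ i, x ∈ closure (D i) := by
    simpa only [closure_iUnion_of_finite, mem_iUnion] using hx.1
  have hxD : x ∈ frontier (D i) := by
    rw [(hD i).isOpen.frontier_eq]
    exact ⟨hi, fun h => hxG (mem_iUnion.2 ⟨i, h⟩)⟩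
  obtain ⟨ψ, hψ⟩ := (hD i).smooth_boundary x hxD
  have hothers : ∀ᶠ y in 𝓝 x, ∀ j, j ≠ i → y ∉ closure (D j) := by
    refine eventually_all.2 fun j => eventually_imp_distrib_left.2 fun hj => ?_
    exact isClosed_closure.isOpen_compl.mem_nhds (disjoint_right.1 (hdisj j i hj) hi)
  refine ⟨ψ, hψ.congr_set ?_⟩
  filter_upwards [hothers] with y hy
  refine ⟨fun h => mem_iUnion.2 ⟨i, h⟩, fun h => ?_⟩
  obtain ⟨j, hj⟩ := mem_iUnion.1 h
  by_cases hji : j = i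
  · exact hji ▸ hj
  · exact absurd (subset_closure hj) (hy j hji)

lemma periodicHoles_eq_iUnion (S : Set (ℝ × ℝ)) :
    periodicHoles S = ⋃ k : ℤ × ℤ, Homeomorph.subRight ((k.1 : ℝ), (k.2 : ℝ)) ⁻¹' S := by
  ext x
  rw [mem_iUnion, Prod.exists]
  rfl

lemma preimage_add_periodicHoles (S : Set (ℝ × ℝ)) (k n : ℤ) :
    (· + ((k : ℝ), (n : ℝ))) ⁻¹' periodicHoles S = periodicHoles S := by
  ext x
  constructor
  · rintro ⟨i, j, h⟩
    refine ⟨i - k, j - n, ?_⟩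
    convert h using 2 <;> push_cast <;> simp only [Prod.fst_add, Prod.snd_add] <;> ring
  · rintro ⟨i, j, h⟩
    refine ⟨i + k, j + n, ?_⟩
    convert h using 2 <;> push_cast <;> simp only [Prod.fst_add, Prod.snd_add] <;> ring

lemma add_mem_periodicHoles_iff (k n : ℤ) :
    x + ((k : ℝ), (n : ℝ)) ∈ periodicHoles S ↔ x ∈ periodicHoles S :=
  Set.ext_iff.1 (preimage_add_periodicHoles S k n) x

lemma eq_zero_of_sub_mem_Ioo {s : ℝ} {k : ℤ} (hs : s ∈ Icc (0 : ℝ) 1)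
    (h : s - k ∈ Ioo (0 : ℝ) 1) : k = 0 := by
  have hlt : (k : ℝ) < 1 := by linarith [h.1, hs.2]
  have hgt : (-1 : ℝ) < k := by linarith [h.2, hs.1]
  norm_cast at hlt hgt
  omega

lemma mem_periodicHoles_iff (hS : S ⊆ Ioo (0 : ℝ) 1 ×ˢ Ioo (0 : ℝ) 1)
    (hx : x ∈ Icc (0 : ℝ) 1 ×ˢ Icc (0 : ℝ) 1) : x ∈ periodicHoles S ↔ x ∈ S := by
  refine ⟨fun ⟨k, n, h⟩ => ?_, fun h => ⟨0, 0, by simpa using h⟩⟩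
  have hk := eq_zero_of_sub_mem_Ioo hx.1 (hS h).1
  have hn := eq_zero_of_sub_mem_Ioo hx.2 (hS h).2
  simpa [hk, hn] using h

lemma snd_ne_intCast_of_mem_periodicHoles (hS : S ⊆ Ioo (0 : ℝ) 1 ×ˢ Ioo (0 : ℝ) 1)
    (hx : x ∈ periodicHoles S) (n : ℤ) : x.2 ≠ n := by
  rintro hn
  obtain ⟨k, m, h⟩ := hx
  obtain ⟨hpos, hlt⟩ := (hS h).2
  simp only [hn] at hpos hlt
  norm_cast at hpos hlt
  omega

lemma locallyFinite_preimage_subRight (hS : S ⊆ Ioo (0 : ℝ) 1 ×ˢ Ioo (0 : ℝ) 1) :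
    LocallyFinite fun k : ℤ × ℤ => Homeomorph.subRight ((k.1 : ℝ), (k.2 : ℝ)) ⁻¹' S := by
  have hfin : ∀ a b : ℝ, (((↑) : ℤ → ℝ) ⁻¹' Ioo a b).Finite := fun a b => by
    rw [Int.preimage_Ioo]
    exact finite_Ioo _ _
  refine fun x => ⟨Metric.ball x 1, Metric.ball_mem_nhds x one_pos,
    ((hfin (x.1 - 2) (x.1 + 1)).prod (hfin (x.2 - 2) (x.2 + 1))).subset ?_⟩
  rintro ⟨k, n⟩ ⟨y, hy, hyx⟩
  obtain ⟨⟨hk0, hk1⟩, hn0, hn1⟩ : y.1 - k ∈ Ioo (0 : ℝ) 1 ∧ y.2 - n ∈ Ioo (0 : ℝ) 1 := hS hy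
  rw [Metric.mem_ball, Prod.dist_eq, max_lt_iff, Real.dist_eq, Real.dist_eq, abs_lt,
    abs_lt] at hyx
  refine ⟨⟨?_, ?_⟩, ?_, ?_⟩ <;> linarith [hyx.1.1, hyx.1.2, hyx.2.1, hyx.2.2]

lemma IsHoleSystem.isOpen_periodicHoles (hG : IsHoleSystem G) : IsOpen (periodicHoles G) := by
  rw [periodicHoles_eq_iUnion]
  exact isOpen_iUnion fun k => hG.isOpen.preimage (Homeomorph.continuous _)

lemma IsHoleSystem.closure_periodicHoles (hG : IsHoleSystem G) :
    closure (periodicHoles G) = periodicHoles (closure G) := by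
  rw [periodicHoles_eq_iUnion, periodicHoles_eq_iUnion,
    (locallyFinite_preimage_subRight (subset_closure.trans hG.closure_subset)).closure_iUnion]
  simp_rw [Homeomorph.preimage_closure]

lemma IsHoleSystem.cell_eq (hG : IsHoleSystem G) :
    cell G = (Icc (0 : ℝ) 1 ×ˢ Icc (0 : ℝ) 1) \ closure (periodicHoles G) := by
  ext x
  refine and_congr_right fun hx => not_congr ?_
  rw [hG.closure_periodicHoles, mem_periodicHoles_iff hG.closure_subset hx]

lemma IsHoleSystem.exists_eq_add_of_mem_frontier (hG : IsHoleSystem G)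
    (hx : x ∈ frontier (periodicHoles G)) :
    ∃ z ∈ frontier G, ∃ k n : ℤ, x = z + ((k : ℝ), (n : ℝ)) ∧
      ∀ᶠ y in 𝓝 z, (y ∈ periodicHoles G ↔ y ∈ G) := by
  rw [hG.isOpen_periodicHoles.frontier_eq, hG.closure_periodicHoles] at hx
  obtain ⟨⟨k, n, hz⟩, hxP⟩ := hx
  refine ⟨(x.1 - k, x.2 - n), ?_, k, n, by simp, ?_⟩
  · rw [hG.isOpen.frontier_eq]
    exact ⟨hz, fun h => hxP ⟨k, n, h⟩⟩
  · filter_upwards [(isOpen_Ioo.prod isOpen_Ioo).mem_nhds (hG.closure_subset hz)] with y hy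
    exact mem_periodicHoles_iff (subset_closure.trans hG.closure_subset)
      ⟨Ioo_subset_Icc_self hy.1, Ioo_subset_Icc_self hy.2⟩

lemma IsHoleSystem.exists_isDefiningFunction_periodicHoles (hG : IsHoleSystem G)
    (hx : x ∈ frontier (periodicHoles G)) : ∃ ψ, IsDefiningFunction (periodicHoles G) x ψ := by
  obtain ⟨z, hz, k, n, rfl, hGP⟩ := hG.exists_eq_add_of_mem_frontier hx
  obtain ⟨ψ, hψ⟩ := hG.exists_isDefiningFunction hz
  have hψP := hψ.congr_set (hGP.mono fun _ => Iff.symm)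
  rw [← add_neg_cancel_right z ((k : ℝ), (n : ℝ))] at hψP
  have hP : (· + -((k : ℝ), (n : ℝ))) ⁻¹' periodicHoles G = periodicHoles G := by
    simpa using preimage_add_periodicHoles G (-k) (-n)
  exact ⟨_, hP ▸ hψP.comp_add_right⟩

lemma IsHoleSystem.isTangential (hG : IsHoleSystem G) {O : Set (ℝ × ℝ)} {F : ℝ × ℝ → ℝ × ℝ}
    (hF : ∀ x ∈ frontier (periodicHoles G), x ∈ O →
      ∀ ν, IsUnitNormalInto (periodicHoles G) x ν → (F x).1 * ν.1 + (F x).2 * ν.2 = 0) :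
    IsTangential (periodicHoles G) O F := fun x hx hxO =>
  ⟨hG.exists_isDefiningFunction_periodicHoles hx, fun _ hψ => hψ.fderiv_eq_zero (hF x hx hxO)⟩

/-- The curve `ξ₁ = ell ξ₂` is of class `C²`, its points with `ξ₂ = 0` and `ξ₂ = 1` have the same
abscissa, and it does not meet the boundary of any hole of the perforated plane. -/
structure IsInterface (G : Set (ℝ × ℝ)) (ell : ℝ → ℝ) : Prop where
  smooth : ContDiff ℝ 2 ell
  apply_one : ell 1 = ell 0
  avoids_holes : ∀ t, (ell t, t) ∉ frontier (periodicHoles G)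

lemma IsInterfaceProfile.isInterface {ell : ℝ → ℝ} (hell : IsInterfaceProfile G ell) :
    IsInterface G ell where
  smooth := hell.smooth.of_le (by norm_num)
  apply_one := by simpa using hell.periodic 0
  avoids_holes := hell.avoids_holes

variable {ell : ℝ → ℝ}

/- The interface either avoids the holes or is contained in one of them; the latter is impossible
as the lines `ξ₂ = n` do not meet the holes. -/
lemma IsInterface.notMem_closure (hell : IsInterface G ell) (hG : IsHoleSystem G) (t : ℝ) :
    (ell t, t) ∉ closure (periodicHoles G) := by
  have hcurve : Continuous fun t => (ell t, t) := hell.smooth.continuous.prodMk continuous_id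
  have hpre : (fun t => (ell t, t)) ⁻¹' closure (periodicHoles G)
      = (fun t => (ell t, t)) ⁻¹' periodicHoles G := by
    refine Subset.antisymm (fun t ht => ?_) (preimage_mono subset_closure)
    by_contra hcon
    exact hell.avoids_holes t (hG.isOpen_periodicHoles.frontier_eq ▸ ⟨ht, hcon⟩)
  have hclopen : IsClopen ((fun t => (ell t, t)) ⁻¹' closure (periodicHoles G)) :=
    ⟨isClosed_closure.preimage hcurve, hpre ▸ hG.isOpen_periodicHoles.preimage hcurve⟩
  rcases isClopen_iff.1 hclopen with hempty | huniv
  · exact fun ht => (hempty.subset ht : t ∈ (∅ : Set ℝ))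
  · have h0 : (ell 0, 0) ∈ closure (periodicHoles G) := huniv.symm.subset (mem_univ 0)
    rw [hG.closure_periodicHoles] at h0
    exact absurd Int.cast_zero.symm (snd_ne_intCast_of_mem_periodicHoles hG.closure_subset h0 0)

lemma IsInterface.closure_inter_shearedRect_subset (hell : IsInterface G ell)
    (hG : IsHoleSystem G) (k n : ℤ) :
    closure (periodicHoles G) ∩ shearedRect ell k n ⊆ openShearedRect ell k n := by
  rintro x ⟨hxP, ⟨hk, hn⟩, h0, h1⟩
  have hcurve : ∀ j : ℤ, x.1 - ell x.2 ≠ j := fun j hj => by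
    refine hell.notMem_closure hG x.2 ?_
    rw [hG.closure_periodicHoles] at hxP ⊢
    rw [← add_mem_periodicHoles_iff j 0]
    convert hxP using 1
    ext <;> simp [← hj]
  have hline : ∀ j : ℤ, x.2 ≠ j := snd_ne_intCast_of_mem_periodicHoles hG.closure_subset
    (hG.closure_periodicHoles ▸ hxP)
  exact ⟨⟨hk.lt_of_ne (hcurve k).symm, hn.lt_of_ne (hcurve n)⟩,
    h0.lt_of_ne (by simpa using (hline 0).symm), h1.lt_of_ne (by simpa using hline 1)⟩

end PeriodicHoles


section Gradient

variable {u : ℝ × ℝ → ℝ} {F : ℝ × ℝ → ℝ × ℝ} {ell : ℝ → ℝ} {x v : ℝ × ℝ}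

lemma contDiffAt_grad (hu : ContDiffAt ℝ 2 u x) : ContDiffAt ℝ 1 (grad u) x := by
  have hfderiv : ContDiffAt ℝ 1 (fderiv ℝ u) x := hu.fderiv_right (by norm_num)
  exact (hfderiv.clm_apply contDiffAt_const).prodMk (hfderiv.clm_apply contDiffAt_const)

lemma divergence_grad (hu : ContDiffAt ℝ 2 u x) : divergence (grad u) x = lap u x := by
  have hgrad : DifferentiableAt ℝ (grad u) x := (contDiffAt_grad hu).differentiableAt one_ne_zero
  have hprod : HasFDerivAt (grad u) ((fderiv ℝ (d1 u) x).prod (fderiv ℝ (d2 u) x)) x :=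
    hgrad.fst.hasFDerivAt.prodMk hgrad.snd.hasFDerivAt
  rw [divergence_eq_add, hprod.fderiv]
  rfl

lemma periodic_of_add_one_snd (hu : ∀ x : ℝ × ℝ, u (x.1, x.2 + 1) = u x) :
    Function.Periodic u (0, 1) :=
  fun x => by simpa only [Prod.add_def, add_zero] using hu x

lemma periodic_fderiv (hu : Function.Periodic u v) : Function.Periodic (fderiv ℝ u) v :=
  fun x => by rw [← fderiv_comp_add_right, funext hu]

lemma periodic_d1 (hu : Function.Periodic u v) : Function.Periodic (d1 u) v :=
  fun x => by rw [d1, periodic_fderiv hu, d1]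

lemma periodic_d2 (hu : Function.Periodic u v) : Function.Periodic (d2 u) v :=
  fun x => by rw [d2, periodic_fderiv hu, d2]

lemma periodic_grad (hu : Function.Periodic u v) : Function.Periodic (grad u) v :=
  fun x => by rw [grad, periodic_d1 hu, periodic_d2 hu, grad]

lemma periodic_lap (hu : Function.Periodic u v) : Function.Periodic (lap u) v :=
  fun x => by rw [lap, periodic_d1 (periodic_d1 hu), periodic_d2 (periodic_d2 hu), lap]

lemma continuous_straighten_fst (hell : ContDiff ℝ 2 ell) {c : ℝ}
    (hF : ∀ t, ContDiffAt ℝ 1 F (c + ell t, t)) :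
    Continuous fun t => (straighten ell F (c, t)).1 :=
  continuous_iff_continuousAt.2 fun t =>
    (contDiffAt_straighten hell (hF t)).continuousAt.fst.comp (x := t) (by fun_prop)

end Gradient

section Rearrangement

lemma shearedRect_zero (a b : ℝ) : shearedRect 0 a b = Icc a b ×ˢ Icc (0 : ℝ) 1 := by
  ext x
  simp only [shearedRect, Pi.zero_apply, sub_zero, mem_prod, mem_ofPred_eq]

lemma setIntegral_shearedRect_of_periodic {ell : ℝ → ℝ} (hell : Continuous ell) {g : ℝ × ℝ → ℝ}
    (hg : IntegrableOn g (shearedRect ell 0 1)) (hper : Function.Periodic g (1, 0)) :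
    ∫ x in shearedRect ell 0 1, g x = ∫ t in Icc (0 : ℝ) 1, ∫ s in (0 : ℝ)..1, g (s, t) := by
  have hshear := ((measurePreserving_shear hell).integrableOn_comp_preimage
    (measurableEmbedding_shear hell)).2 hg
  rw [preimage_shear_shearedRect, IntegrableOn, Measure.volume_eq_prod,
    ← Measure.prod_restrict] at hshear
  rw [setIntegral_shearedRect hell, Measure.volume_eq_prod, ← Measure.prod_restrict]
  refine (integral_prod_symm _ hshear).trans (integral_congr_ae (.of_forall fun t => ?_))
  have hrow : Function.Periodic (fun s => g (s, t)) 1 := fun s => by simpa using hper (s, t)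
  calc ∫ s in Icc (0 : ℝ) 1, g (s + ell t, t)
      = ∫ s in (0 : ℝ)..1, g (s + ell t, t) := by
        rw [integral_Icc_eq_integral_Ioc, intervalIntegral.integral_of_le zero_le_one]
    _ = ∫ s in ell t..ell t + 1, g (s, t) := by
        rw [intervalIntegral.integral_comp_add_right fun s => g (s, t), zero_add, add_comm 1]
    _ = ∫ s in (0 : ℝ)..1, g (s, t) := by
        rw [hrow.intervalIntegral_add_eq (ell t) 0, zero_add]

end Rearrangement

section Cell

variable {G : Set (ℝ × ℝ)} {N : ℝ × ℝ → ℝ} {ell : ℝ → ℝ} {x : ℝ × ℝ}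

/-- The gradient of `ξ₁ + N`. -/
noncomputable def cellField (N : ℝ × ℝ → ℝ) (x : ℝ × ℝ) : ℝ × ℝ := (1, 0) + grad N x

lemma IsCellSolution.periodic (hN : IsCellSolution G N) (k n : ℤ) :
    Function.Periodic N ((k : ℝ), (n : ℝ)) := by
  have h1 : Function.Periodic N (1, 0) := fun x => by
    simpa only [Prod.add_def, add_zero] using hN.periodic_fst x
  have h2 := periodic_of_add_one_snd hN.periodic_snd
  simpa using (h1.zsmul k).add_period (h2.zsmul n)

lemma IsCellSolution.cellField_add (hN : IsCellSolution G N) (k n : ℤ) (x : ℝ × ℝ) :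
    cellField N (x + ((k : ℝ), (n : ℝ))) = cellField N x := by
  rw [cellField, periodic_grad (hN.periodic k n), cellField]

lemma IsCellSolution.contDiffAt_grad (hN : IsCellSolution G N) (hx : x ∉ periodicHoles G) :
    ContDiffAt ℝ 1 (grad N) x :=
  PerforatedCell.contDiffAt_grad ((hN.smooth x hx).of_le (by decide))

lemma IsCellSolution.contDiffAt_cellField (hN : IsCellSolution G N) (hx : x ∉ periodicHoles G) :
    ContDiffAt ℝ 1 (cellField N) x :=
  contDiffAt_const.add (hN.contDiffAt_grad hx)

lemma IsCellSolution.lap_eq_zero (hN : IsCellSolution G N) (hG : IsHoleSystem G)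
    (hx : x ∉ closure (periodicHoles G)) : lap N x = 0 := by
  obtain ⟨y, hy, k, n, rfl⟩ : ∃ y ∈ Icc (0 : ℝ) 1 ×ˢ Icc (0 : ℝ) 1, ∃ k n : ℤ,
      x = y + ((k : ℝ), (n : ℝ)) :=
    ⟨(Int.fract x.1, Int.fract x.2), ⟨⟨Int.fract_nonneg _, (Int.fract_lt_one _).le⟩,
      Int.fract_nonneg _, (Int.fract_lt_one _).le⟩, ⌊x.1⌋, ⌊x.2⌋, by simp⟩
  rw [hG.closure_periodicHoles, add_mem_periodicHoles_iff, ← hG.closure_periodicHoles] at hx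
  rw [periodic_lap (hN.periodic k n)]
  exact hN.harmonic y (hG.cell_eq ▸ ⟨hy, hx⟩)

lemma IsCellSolution.cellField_normal (hN : IsCellSolution G N) (hG : IsHoleSystem G)
    (hx : x ∈ frontier (periodicHoles G)) {ν : ℝ × ℝ}
    (hν : IsUnitNormalInto (periodicHoles G) x ν) :
    (cellField N x).1 * ν.1 + (cellField N x).2 * ν.2 = 0 := by
  obtain ⟨z, hz, k, n, rfl, hGP⟩ := hG.exists_eq_add_of_mem_frontier hx
  have hνG := (preimage_add_periodicHoles G k n ▸ hν.preimage_add_right).congr_set hGP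
  have hneumann := hN.neumann z hz ν hνG
  rw [normalDeriv] at hneumann
  rw [hN.cellField_add]
  simp only [cellField, grad, Prod.fst_add, Prod.snd_add]
  linarith

lemma IsCellSolution.isSolenoidal (hN : IsCellSolution G N) (hG : IsHoleSystem G)
    (hell : IsInterface G ell) : IsSolenoidal (periodicHoles G) ell 0 1 (cellField N) where
  closure_inter_subset := by simpa using hell.closure_inter_shearedRect_subset hG 0 1
  contDiffAt x _ hx := hN.contDiffAt_cellField (hG.isOpen_periodicHoles.interior_eq ▸ hx)
  isTangential := hG.isTangential fun _ hx _ _ hν => hN.cellField_normal hG hx hν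
  divergence_eq_zero x _ hx := by
    have hN2 : ContDiffAt ℝ 2 N x :=
      (hN.smooth x fun h => hx (subset_closure h)).of_le (by decide)
    have hfderiv : fderiv ℝ (cellField N) x = fderiv ℝ (grad N) x := fderiv_const_add _
    rw [divergence, hfderiv, ← divergence, divergence_grad hN2, hN.lap_eq_zero hG hx]
  periodic s := by simpa using hN.cellField_add 0 1 (s, 0)

/- Green's formula with the test function `ξ₁`, which grows by one from the left curve to the
right one, where the fluxes agree by periodicity. -/
lemma IsCellSolution.setIntegral_shearedRect (hN : IsCellSolution G N) (hG : IsHoleSystem G)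
    (hell : IsInterface G ell) :
    ∫ x in shearedRect ell 0 1 \ closure (periodicHoles G), (1 + d1 N x)
      = flux ell (cellField N) 0 := by
  have hgreen := (hN.isSolenoidal hG hell).setIntegral_fderiv_apply (w := Prod.fst) hell.smooth
    hell.apply_one zero_le_one (fun _ _ _ => contDiffAt_fst) fun _ => rfl
  have hcurve : ∀ k : ℤ, ∀ t, ((k : ℝ) + ell t, t) ∉ periodicHoles G := fun k t ht => by
    refine hell.notMem_closure hG t (subset_closure ((add_mem_periodicHoles_iff k 0).1 ?_))
    simpa [add_comm] using ht
  have hcont : ∀ k : ℤ, Continuous fun t =>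
      (straighten ell ((Prod.fst : ℝ × ℝ → ℝ) • cellField N) (k, t)).1 := fun k =>
    continuous_straighten_fst hell.smooth fun t =>
      contDiffAt_fst.smul (hN.contDiffAt_cellField (hcurve k t))
  have hfield : ∀ t, cellField N (1 + ell t, t) = cellField N (0 + ell t, t) := fun t => by
    simpa [add_comm] using hN.cellField_add 1 0 (ell t, t)
  rw [flux, flux, ← intervalIntegral.integral_sub
    (by simpa using (hcont 1).intervalIntegrable 0 1)
    (by simpa using (hcont 0).intervalIntegrable 0 1)] at hgreen
  rw [← setIntegral_congr_set (openShearedRect_diff_ae_eq hell.smooth.continuous _)]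
  simp only [fderiv_fst, ContinuousLinearMap.coe_fst', straighten, shear, Pi.smul_apply', hfield,
    Prod.smul_fst, Prod.smul_snd, smul_eq_mul] at hgreen
  refine hgreen.trans (intervalIntegral.integral_congr fun t _ => ?_)
  simp only [straighten, shear]
  ring

lemma IsCellSolution.integrableOn_diff (hN : IsCellSolution G N) (hG : IsHoleSystem G)
    {K : Set (ℝ × ℝ)} (hK : IsCompact K) :
    IntegrableOn (fun x => 1 + d1 N x) (K \ closure (periodicHoles G)) :=
  (ContinuousOn.integrableOn_compact (hK.diff hG.isOpen_periodicHoles) fun _ hx =>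
    (hN.contDiffAt_cellField hx.2).continuousAt.fst.continuousWithinAt).mono_set
      (sdiff_subset_sdiff_right subset_closure)

lemma IsCellSolution.setIntegral_cell (hN : IsCellSolution G N) (hG : IsHoleSystem G)
    (hell : Continuous ell) :
    ∫ x in cell G, (1 + d1 N x)
      = ∫ x in shearedRect ell 0 1 \ closure (periodicHoles G), (1 + d1 N x) := by
  have hmeas : MeasurableSet (closure (periodicHoles G))ᶜ := isClosed_closure.measurableSet.compl
  set g := indicator (closure (periodicHoles G))ᶜ fun x => 1 + d1 N x with hg
  have hper : Function.Periodic g (1, 0) := fun x => by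
    have hd1 := periodic_d1 (hN.periodic 1 0) x
    have hmem := add_mem_periodicHoles_iff (S := closure G) (x := x) 1 0
    simp only [Int.cast_one, Int.cast_zero] at hd1 hmem
    classical
    simp only [hg, indicator_apply, mem_compl_iff, hG.closure_periodicHoles, hmem, hd1]
  have hrect : ∀ f : ℝ → ℝ, Continuous f →
      ∫ x in shearedRect f 0 1 \ closure (periodicHoles G), (1 + d1 N x)
        = ∫ t in Icc (0 : ℝ) 1, ∫ s in (0 : ℝ)..1, g (s, t) := fun f hf => by
    have hint : IntegrableOn g (shearedRect f 0 1) := by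
      rw [hg, IntegrableOn, integrable_indicator_iff hmeas, IntegrableOn,
        Measure.restrict_restrict hmeas, inter_comm, ← Set.sdiff_eq]
      exact hN.integrableOn_diff hG (isCompact_shearedRect hf)
    rw [← setIntegral_shearedRect_of_periodic hf hint hper, hg, setIntegral_indicator hmeas,
      Set.sdiff_eq]
  rw [hG.cell_eq, ← shearedRect_zero, hrect _ continuous_zero, hrect ell hell]

lemma volume_cell_mul_h11 (G : Set (ℝ × ℝ)) (N : ℝ × ℝ → ℝ) :
    volume.real (cell G) * h11 G N = ∫ x in cell G, (1 + d1 N x) := by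
  rw [h11, cellAverage]
  by_cases h : volume.real (cell G) = 0
  · have hfin : volume (cell G) ≠ ⊤ :=
      measure_ne_top_of_subset sdiff_subset (isCompact_Icc.prod isCompact_Icc).measure_ne_top
    rw [h, zero_mul, setIntegral_measure_zero _ ((measureReal_eq_zero_iff hfin).1 h)]
  · field_simp

lemma IsCellSolution.flux_grad_eq (hN : IsCellSolution G N) (hG : IsHoleSystem G)
    (hell : IsInterface G ell) :
    flux ell (grad N) 0 = -1 + volume.real (cell G) * h11 G N := by
  have hcont : Continuous fun t => (straighten ell (grad N) (0, t)).1 :=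
    continuous_straighten_fst hell.smooth fun t => hN.contDiffAt_grad fun h =>
      hell.notMem_closure hG t (subset_closure (by simpa using h))
  have hfield : flux ell (cellField N) 0 = 1 + flux ell (grad N) 0 := by
    have hsum : ∀ t, (straighten ell (cellField N) (0, t)).1
        = 1 + (straighten ell (grad N) (0, t)).1 := fun t => by
      simp only [straighten, cellField, Prod.fst_add, Prod.snd_add]
      ring
    simp only [flux, hsum]
    rw [intervalIntegral.integral_add intervalIntegrable_const (hcont.intervalIntegrable 0 1)]
    simp
  rw [volume_cell_mul_h11, hN.setIntegral_cell hG hell.smooth.continuous,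
    hN.setIntegral_shearedRect hG hell, hfield]
  ring

end Cell


section Layer

variable {G H S : Set (ℝ × ℝ)} {N B Bp Bm : ℝ × ℝ → ℝ} {ell : ℝ → ℝ} {Dm q J : ℝ}

lemma eventually_forall_shearedRect_abs_le {l : Filter ℝ} [TendstoIxxClass Icc l l]
    (hl : ∀ r, Tendsto (· + r) l l) (hell : Continuous ell)
    (hB : Tendsto B (comap Prod.fst l ⊓ 𝓟 S) (𝓝 0)) {δ : ℝ} (hδ : 0 < δ) :
    ∀ᶠ c in l, ∀ x ∈ shearedRect ell c (c + 1) ∩ S, |B x| ≤ δ := by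
  obtain ⟨E, hE⟩ := isCompact_Icc.exists_bound_of_continuousOn (s := Icc (0 : ℝ) 1)
    hell.continuousOn
  have hsmall : ∀ᶠ r in l, ∀ x : ℝ × ℝ, x.1 = r → x ∈ S → |B x| ≤ δ := by
    have h := hB.eventually (Metric.closedBall_mem_nhds 0 hδ)
    simpa only [eventually_inf_principal, eventually_comap, Metric.mem_closedBall,
      Real.dist_0_eq_abs] using h
  filter_upwards [((hl (-E)).Icc (hl (1 + E))).eventually (eventually_smallSets.2
    ⟨_, hsmall, fun _ h => h⟩)] with c hc x hx
  have hx2 := abs_le.1 (hE x.2 hx.1.2)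
  exact hc ⟨by linarith [hx.1.1.1], by linarith [hx.1.1.2]⟩ x rfl hx.2

lemma eq_zero_of_flux_grad_eq_of_tendsto {l : Filter ℝ} [TendstoIxxClass Icc l l]
    (hl : ∀ r, Tendsto (· + r) l l) (hell : ContDiff ℝ 2 ell) (hell1 : ell 1 = ell 0)
    (hBper : ∀ s, B (s, 1) = B (s, 0)) (hB : Tendsto B (comap Prod.fst l ⊓ 𝓟 S) (𝓝 0)) {φ : ℝ}
    (hφ : ∃ᶠ c in l, flux ell (grad B) c = φ ∧ IsSolenoidal H ell c (c + 1) (grad B) ∧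
      (∀ x ∈ shearedRect ell c (c + 1), x ∉ interior H → ContDiffAt ℝ 1 B x) ∧
      openShearedRect ell c (c + 1) \ closure H ⊆ S) :
    φ = 0 := by
  have hslope : Continuous fun t => 1 + deriv ell t ^ 2 := by
    have := hell.continuous_deriv one_le_two
    fun_prop
  obtain ⟨C, hC⟩ := isCompact_Icc.exists_bound_of_continuousOn (s := Icc (0 : ℝ) 1)
    hslope.continuousOn
  have hbound : ∀ δ > 0, |φ| ≤ 60 * C * δ := fun δ hδ => by
    obtain ⟨c, ⟨rfl, hsol, hBs, hS⟩, hsmall⟩ :=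
      (hφ.and_eventually (eventually_forall_shearedRect_abs_le hl hell.continuous hB hδ)).exists
    exact hsol.abs_flux_grad_le hBs hBper hell hell1 (fun t ht => (le_abs_self _).trans (hC t ht))
      hδ fun x hx => hsmall x ⟨openShearedRect_subset hx.1, hS hx⟩
  have hlim : Tendsto (fun δ => 60 * C * δ) (𝓝[>] 0) (𝓝 0) :=
    tendsto_nhdsWithin_of_tendsto_nhds
      (by simpa using (tendsto_id (x := 𝓝 (0 : ℝ))).const_mul (60 * C))
  exact abs_nonpos_iff.1 (ge_of_tendsto hlim (eventually_mem_nhdsWithin.mono hbound))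

lemma IsInnerLayerSolution.isSolenoidal_plus (hB : IsInnerLayerSolution G ell N Dm q J Bp Bm)
    (hG : IsHoleSystem G) (hell : IsInterface G ell) {k n : ℤ} (hk : 0 ≤ k) :
    IsSolenoidal (periodicHoles G) ell k n (grad Bp) where
  closure_inter_subset := hell.closure_inter_shearedRect_subset hG k n
  contDiffAt x hx hxP := contDiffAt_grad <| hB.smooth_plus x
    (sub_nonneg.1 ((Int.cast_nonneg hk).trans hx.1.1)) (hG.isOpen_periodicHoles.interior_eq ▸ hxP)
  isTangential := hG.isTangential fun x hx hxO ν hν => hB.neumann x hx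
    (sub_pos.1 ((Int.cast_nonneg hk).trans_lt hxO.1.1)) hxO.2.1 hxO.2.2 ν hν
  divergence_eq_zero x hx hxP := by
    have hcurve : ell x.2 < x.1 := sub_pos.1 ((Int.cast_nonneg hk).trans_lt hx.1.1)
    rw [divergence_grad (hB.smooth_plus x hcurve.le fun h => hxP (subset_closure h)),
      hB.harmonic_plus x ⟨hcurve, hx.2.1, hx.2.2, hxP⟩]
  periodic s := by simpa using periodic_grad (periodic_of_add_one_snd hB.periodic_plus) (s, 0)

lemma IsInnerLayerSolution.isSolenoidal_minus (hB : IsInnerLayerSolution G ell N Dm q J Bp Bm)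
    {a b : ℝ} (hb : b ≤ 0) : IsSolenoidal ∅ ell a b (grad Bm) where
  closure_inter_subset := by simp
  contDiffAt x hx _ := contDiffAt_grad (hB.smooth_minus x (sub_nonpos.1 (hx.1.2.trans hb)))
  isTangential x hx := by simp at hx
  divergence_eq_zero x hx _ := by
    have hcurve : x.1 < ell x.2 := sub_neg.1 (hx.1.2.trans_le hb)
    rw [divergence_grad (hB.smooth_minus x hcurve.le),
      hB.harmonic_minus x ⟨hcurve, hx.2.1, hx.2.2⟩]
  periodic s := by simpa using periodic_grad (periodic_of_add_one_snd hB.periodic_minus) (s, 0)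

lemma IsInnerLayerSolution.flux_grad_plus (hB : IsInnerLayerSolution G ell N Dm q J Bp Bm)
    (hG : IsHoleSystem G) (hell : IsInterface G ell) : flux ell (grad Bp) 0 = 0 := by
  refine eq_zero_of_flux_grad_eq_of_tendsto (H := periodicHoles G)
    (fun r => tendsto_atTop_add_const_right _ r tendsto_id) hell.smooth hell.apply_one
    (fun s => by simpa using hB.periodic_plus (s, 0)) hB.decay_plus
    (tendsto_natCast_atTop_atTop.frequently (Frequently.of_forall fun m : ℕ => ?_))
  have hm : (0 : ℝ) ≤ m := m.cast_nonneg
  refine ⟨?_, ?_, fun x hx hxP => ?_, fun x hx => ⟨?_, hx.1.2.1, hx.1.2.2, hx.2⟩⟩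
  · simpa using (hB.isSolenoidal_plus hG hell (k := 0) (n := m) le_rfl).flux_eq hell.smooth
      hell.apply_one (by simp)
  · simpa using hB.isSolenoidal_plus hG hell (k := m) (n := m + 1) (Int.natCast_nonneg m)
  · exact (hB.smooth_plus x (sub_nonneg.1 (hm.trans hx.1.1))
      (hG.isOpen_periodicHoles.interior_eq ▸ hxP)).of_le one_le_two
  · exact sub_pos.1 (hm.trans_lt hx.1.1.1)

lemma IsInnerLayerSolution.flux_grad_minus (hB : IsInnerLayerSolution G ell N Dm q J Bp Bm)
    (hell : ContDiff ℝ 2 ell) (hell1 : ell 1 = ell 0) : flux ell (grad Bm) 0 = 0 := by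
  refine eq_zero_of_flux_grad_eq_of_tendsto (H := ∅)
    (fun r => tendsto_atBot_add_const_right _ r tendsto_id) hell hell1
    (fun s => by simpa using hB.periodic_minus (s, 0)) hB.decay_minus
    ((eventually_le_atBot (-1)).mono fun c hc => ?_).frequently
  have hc1 : c + 1 ≤ 0 := by linarith
  refine ⟨?_, hB.isSolenoidal_minus hc1, fun x hx _ => ?_, fun x hx => ⟨?_, hx.1.2⟩⟩
  · exact ((hB.isSolenoidal_minus le_rfl).flux_eq hell hell1 (by linarith)).symm
  · exact (hB.smooth_minus x (sub_nonpos.1 (hx.1.2.trans hc1))).of_le one_le_two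
  · exact sub_neg.1 (hx.1.1.2.trans_le hc1)

end Layer

section Interface

variable {G : Set (ℝ × ℝ)} {N Bp Bm : ℝ × ℝ → ℝ} {ell : ℝ → ℝ} {Dm q J : ℝ}

lemma sqrt_one_add_sq_pos (s : ℝ) : 0 < √(1 + s ^ 2) := Real.sqrt_pos.2 (by positivity)

lemma normalDeriv_mul_sqrt (u : ℝ × ℝ → ℝ) (ell : ℝ → ℝ) (t : ℝ) :
    normalDeriv u (ell t, t) (interfaceNormal ell t) * √(1 + deriv ell t ^ 2)
      = (straighten ell (grad u) (0, t)).1 := by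
  have hsqrt := (sqrt_one_add_sq_pos (deriv ell t)).ne'
  simp only [normalDeriv, interfaceNormal, straighten, shear, grad, zero_add]
  field_simp
  ring

lemma lineIntegral_normalDeriv (u : ℝ × ℝ → ℝ) (ell : ℝ → ℝ) :
    lineIntegral ell (fun t => normalDeriv u (ell t, t) (interfaceNormal ell t))
      = flux ell (grad u) 0 := by
  simp only [lineIntegral, normalDeriv_mul_sqrt, flux]

lemma IsInnerLayerSolution.straighten_grad_sub (hB : IsInnerLayerSolution G ell N Dm q J Bp Bm)
    {t : ℝ} (ht : t ∈ Ioo (0 : ℝ) 1) :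
    (straighten ell (grad Bp) (0, t)).1 - Dm * (straighten ell (grad Bm) (0, t)).1
      = J - (straighten ell (grad N) (0, t)).1 := by
  have hnormal : (interfaceNormal ell t).1 * √(1 + deriv ell t ^ 2) = 1 :=
    one_div_mul_cancel (sqrt_one_add_sq_pos _).ne'
  simp only [← normalDeriv_mul_sqrt]
  linear_combination √(1 + deriv ell t ^ 2) * hB.flux_jump t ht + J * hnormal

lemma IsInnerLayerSolution.flux_grad_sub (hB : IsInnerLayerSolution G ell N Dm q J Bp Bm)
    (hG : IsHoleSystem G) (hN : IsCellSolution G N) (hell : IsInterface G ell) :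
    flux ell (grad Bp) 0 - Dm * flux ell (grad Bm) 0 = J - flux ell (grad N) 0 := by
  have hcurve : ∀ t, (0 + ell t, t) ∉ periodicHoles G := fun t h =>
    hell.notMem_closure hG t (subset_closure (by simpa using h))
  have hp := (continuous_straighten_fst hell.smooth fun t => contDiffAt_grad
    (hB.smooth_plus (0 + ell t, t) (by simp) (hcurve t))).intervalIntegrable (μ := volume) 0 1
  have hm := (continuous_straighten_fst hell.smooth fun t => contDiffAt_grad
    (hB.smooth_minus (0 + ell t, t) (by simp))).intervalIntegrable (μ := volume) 0 1
  have hn := (continuous_straighten_fst hell.smooth fun t =>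
    hN.contDiffAt_grad (hcurve t)).intervalIntegrable (μ := volume) 0 1
  have hjump := intervalIntegral.integral_congr_Ioo_of_le zero_le_one (μ := volume) fun t ht =>
    hB.straighten_grad_sub ht
  rw [intervalIntegral.integral_sub hp (hm.const_mul Dm), intervalIntegral.integral_const_mul,
    intervalIntegral.integral_sub intervalIntegrable_const hn] at hjump
  simpa [flux] using hjump

lemma IsInnerLayerSolution.const_eq_flux (hB : IsInnerLayerSolution G ell N Dm q J Bp Bm)
    (hG : IsHoleSystem G) (hN : IsCellSolution G N) (hell : IsInterface G ell) :
    J = flux ell (grad N) 0 := by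
  have hjump := hB.flux_grad_sub hG hN hell
  rw [hB.flux_grad_plus hG hell, hB.flux_grad_minus hell.smooth hell.apply_one] at hjump
  linarith

end Interface

end PerforatedCell

theorem proposition5p1_general
    (G : Set (ℝ × ℝ)) (hG : PerforatedCell.IsHoleSystem G)
    (N : ℝ × ℝ → ℝ) (hN : PerforatedCell.IsCellSolution G N)
    (ell : ℝ → ℝ) (hell : PerforatedCell.IsInterface G ell) :
    PerforatedCell.lineIntegral ell (fun t =>
        PerforatedCell.normalDeriv N (ell t, t) (PerforatedCell.interfaceNormal ell t))
      = -1 + volume.real (PerforatedCell.cell G) * PerforatedCell.h11 G N ∧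
    ∀ (Dm q J : ℝ) (Bp Bm : ℝ × ℝ → ℝ),
      PerforatedCell.IsInnerLayerSolution G ell N Dm q J Bp Bm →
        J = -1 + volume.real (PerforatedCell.cell G) * PerforatedCell.h11 G N := by
  have hflux := hN.flux_grad_eq hG hell
  exact ⟨(PerforatedCell.lineIntegral_normalDeriv N ell).trans hflux,
    fun _ _ _ _ _ hB => (hB.const_eq_flux hG hN hell).trans hflux⟩

theorem proposition5p1
    (G : Set (ℝ × ℝ)) (hG : PerforatedCell.IsHoleSystem G)
    (hsymm : PerforatedCell.IsSymmetricCell G)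
    (N : ℝ × ℝ → ℝ) (hN : PerforatedCell.IsCellSolution G N)
    (ell : ℝ → ℝ) (hell : PerforatedCell.IsInterfaceProfile G ell) :
    PerforatedCell.lineIntegral ell (fun t =>
        PerforatedCell.normalDeriv N (ell t, t) (PerforatedCell.interfaceNormal ell t))
      = -1 + volume.real (PerforatedCell.cell G) * PerforatedCell.h11 G N ∧
    ∀ (Dm : ℝ), 0 < Dm → ∀ (q J : ℝ) (Bp Bm : ℝ × ℝ → ℝ),
      PerforatedCell.IsInnerLayerSolution G ell N Dm q J Bp Bm →
        J = -1 + volume.real (PerforatedCell.cell G) * PerforatedCell.h11 G N := by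
  have h := proposition5p1_general G hG N hN ell hell.isInterface
  exact ⟨h.1, fun Dm _ => h.2 Dm⟩
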